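/- Fix an integer $n\ge 2$. **Columns.** A *PBW-semistandard column* is a sequence $(\alpha_1,\dots,\alpha_k)$ with $1\le k\le n-1$ and all $\alpha_r\in\{1,\dots,n\}$, such that $\alpha_r\le k$ implies $\alpha_r=r$, and such that $\alpha_r>\alpha_s$ whenever $r<s$ and $\alpha_r,\alpha_s>k$. Let $\mathcal N$ be the set of all these columns, ordered by: $(\beta_1,\dots,\beta_l)\le(\alpha_1,\dots,\alpha_k)$ if and only if $l\le k$ and for every $r\le l$ there is an $s$ with $r\le s\le k$ and $\alpha_s\ge\beta_r$. This is a finite distributive lattice; write $\land,\lor$ for its meet and join. **The Plücker ideal.** Let $R$ be the polynomial ring over $\mathbb C$ in the Plücker variables $X_{i_1,\dots,i_k}$, $1\le k\le n-1$, $1\le i_1<\dots<i_k\le n$. Put $X_{i_{\sigma(1)},\dots,i_{\sigma(k)}}=(-1)^\sigma X_{i_1,\dots,i_k}$ for $\sigma\in S_k$, and $X_a=X_{\alpha_1,\dots,\alpha_k}$ for $a=(\alpha_1,\dots,\alpha_k)\in\mathcal N$; then $R=\mathbb C[X_a : a\in\mathcal N]$. Let $I\subset R$ be the ideal of Plücker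 relations of the variety of complete flags in $\mathbb C^n$, that is, the kernel of the homomorphism $R\to\mathbb C[z_{i,j} : 1\le i,j\le n]$ that maps $X_{i_1,\dots,i_k}$ to $\det(z_{p,i_q})_{1\le p,q\le k}$. **Straightening relations.** A monomial in the $X_a$ is *standard* if its factors are indexed by pairwise comparable elements of $\mathcal N$. For incomparable $a,b\in\mathcal N$ let $e(a,b)$ be the element of $I$ of the form $X_aX_b+Q$, where $Q$ is a linear combination of standard monomials. **The operation $\odot$.** Let $\mathcal P$ be the set of join-irreducible elements of $\mathcal N$, let $V_o\subset\mathcal P$ consist of the columns $(1,2,\dots,k)$ with $2\le k\le n-1$, and let $V_c=\mathcal P\setminus V_o$. For $a\in\mathcal N$ let $\iota(a)=\{p\in\mathcal P : p\le a\}$. For an order ideal $J\subset\mathcal P$ let $K(J)$ consist of all elements of $J\cap V_o$ and of those elements of $J\cap V_c$ that are maximal in $J$. Then $a\odot b$ is the unique element of $\mathcal N$ such that, for indicator functions, $$\mathbf 1_{K(\iota(a))}+\mathbf 1_{K(\iota(b))}=\mathbf 1_{K(\iota(a)\cup\iota(b))}+\mathbf 1_{K(\iota(a\odot b))}.$$ **Theorem.**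 For all incomparable $a,b\in\mathcal N$ the relation $e(a,b)$ exists and is unique. Moreover: (a) The relations $e(a,b)$, over all incomparable pairs $\{a,b\}\subset\mathcal N$, form a minimal generating set of $I$: they generate $I$, and no proper subset of them does. (b), (c) For all incomparable $a,b\in\mathcal N$ one can write $$e(a,b)=X_aX_b-\sum_{i=0}^{m}c_i\,X_{g_i}X_{h_i}$$ with $m\ge 0$, pairwise distinct pairs $(g_i,h_i)\in\mathcal N^2$ with $g_i<h_i$, and nonzero $c_i\in\mathbb C$, such that $g_0=a\odot b$, $h_0=a\lor b$, $c_0=1$, and $g_i\le a\land b$, $h_i>a\lor b$ for all $1\le i\le m$. In particular, $R/I$ is an algebra with straightening laws on $\mathcal N$ with respect to the map $\varepsilon'$ that sends $a$ to the class of $X_a$: the map $\varepsilon'$ is injective; the products $\varepsilon'(\omega_1)\cdots\varepsilon'(\omega_m)$ with $m\ge 0$ and $\omega_1\le\dots\le\omega_m$ in $\mathcal N$ form a $\mathbb C$-basis of $R/I$; and for incomparable $\chi_1,\chi_2\in\mathcal N$, every product $\varepsilon'(\omega_1)\cdots\varepsilon'(\omega_m)$ with $\omega_1\le\dots\le\omega_m$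 that occurs in the expansion of $\varepsilon'(\chi_1)\varepsilon'(\chi_2)$ in this basis has $m\ge 1$, $\omega_1\le\chi_1$ and $\omega_1\le\chi_2$. -/

import Mathlib

/-! ### PBW-semistandard columns and their lattice -/

/-- A one-column PBW-semistandard tableau `(α₁, …, α_k)` with `1 ≤ k ≤ n - 1` on the alphabet
`{1, …, n}`. Positions and letters are both numbered from `0`: `entry r` is `α_{r+1} - 1`. -/
@[ext]
structure PBWColumn (n : ℕ) where
  /-- the height `k` of the column -/
  len : ℕ
  len_pos : 1 ≤ len
  len_lt : len < n
  /-- the entries, from top to bottom -/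
  entry : Fin len → Fin n
  /-- `α_r ≤ k` implies `α_r = r` -/
  fixed : ∀ r, (entry r : ℕ) < len → (entry r : ℕ) = r
  /-- the entries exceeding `k` decrease -/
  decr : ∀ r s, r < s → len ≤ (entry r : ℕ) → len ≤ (entry s : ℕ) → entry s < entry r

namespace PBWColumn

variable {n : ℕ}

/-- `b ≤ a` if the two-column tableau with columns `a`, `b` (in this order) is PBW-semistandard:
`b` is not longer than `a`, and for every entry `β_r` of `b` there is `s ≥ r` with `α_s ≥ β_r`. -/
instance : LE (PBWColumn n) where
  le b a := b.len ≤ a.len ∧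
    ∀ r : Fin b.len, ∃ s : Fin a.len, (r : ℕ) ≤ (s : ℕ) ∧ b.entry r ≤ a.entry s

theorem le_def {a b : PBWColumn n} : b ≤ a ↔ b.len ≤ a.len ∧
    ∀ r : Fin b.len, ∃ s : Fin a.len, (r : ℕ) ≤ (s : ℕ) ∧ b.entry r ≤ a.entry s := Iff.rfl

/-- Auxiliary, for the lattice structure: the largest letter at or below a position
(letters numbered from `1`, and `0` past the end of the column). -/
def prof (a : PBWColumn n) (r : ℕ) : ℕ :=
  (Finset.univ.filter fun s : Fin a.len => r ≤ (s : ℕ)).sup fun s => (a.entry s : ℕ) + 1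

theorem le_prof (a : PBWColumn n) {r : ℕ} (s : Fin a.len) (h : r ≤ s) :
    (a.entry s : ℕ) + 1 ≤ a.prof r :=
  Finset.le_sup (f := fun s => (a.entry s : ℕ) + 1) (by simpa using h)

theorem prof_le_iff (a : PBWColumn n) {r m : ℕ} :
    a.prof r ≤ m ↔ ∀ s : Fin a.len, r ≤ s → (a.entry s : ℕ) + 1 ≤ m := by
  simp [prof, Finset.sup_le_iff]

theorem lt_prof_iff (a : PBWColumn n) {r m : ℕ} :
    m < a.prof r ↔ ∃ s : Fin a.len, r ≤ s ∧ m < (a.entry s : ℕ) + 1 := by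
  simp [prof, Finset.lt_sup_iff]

theorem prof_eq_zero (a : PBWColumn n) {r : ℕ} (h : a.len ≤ r) : a.prof r = 0 := by
  refine Nat.le_zero.1 ((a.prof_le_iff).2 fun s hs => ?_)
  have := s.2
  omega

theorem prof_antitone (a : PBWColumn n) : Antitone a.prof := fun _ _ h =>
  (a.prof_le_iff).2 fun s hs => a.le_prof s (h.trans hs)

theorem prof_le (a : PBWColumn n) (r : ℕ) : a.prof r ≤ n :=
  (a.prof_le_iff).2 fun s _ => (a.entry s).2

theorem le_entry (a : PBWColumn n) (r : Fin a.len) : (r : ℕ) ≤ a.entry r := by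
  by_cases h : (a.entry r : ℕ) < a.len
  · exact (a.fixed r h).ge
  · have := r.2
    omega

theorem len_le_prof (a : PBWColumn n) {r : ℕ} (h : r < a.len) : a.len ≤ a.prof r := by
  have h1 := a.le_entry ⟨a.len - 1, by omega⟩
  have h2 := a.le_prof (r := r) ⟨a.len - 1, by omega⟩ (by simp; omega)
  simp only at h1
  omega

theorem prof_succ (a : PBWColumn n) (r : Fin a.len) :
    a.prof r = max ((a.entry r : ℕ) + 1) (a.prof (r + 1)) := by
  apply le_antisymm
  · refine (a.prof_le_iff).2 fun s hs => ?_
    rcases eq_or_lt_of_le hs with h | h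
    · rw [← Fin.ext h]
      exact le_max_left _ _
    · exact (a.le_prof s h).trans (le_max_right _ _)
  · exact max_le (a.le_prof r le_rfl) (a.prof_antitone (Nat.le_succ _))

theorem entry_eq (a : PBWColumn n) (r : Fin a.len) :
    (a.entry r : ℕ) = if a.prof (r + 1) < a.prof r then a.prof r - 1 else (r : ℕ) := by
  have h := a.prof_succ r
  split_ifs with hlt
  · have : a.prof r = (a.entry r : ℕ) + 1 := by
      rcases max_choice ((a.entry r : ℕ) + 1) (a.prof (r + 1)) with h' | h' <;> omega
    omega
  · have h1 : (a.entry r : ℕ) < a.prof (r + 1) := by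
      have := a.le_prof r le_rfl
      omega
    obtain ⟨s, hs, hs'⟩ := (a.lt_prof_iff).1 h1
    by_contra hne
    have hr : a.len ≤ (a.entry r : ℕ) := by
      by_contra hr
      exact hne (a.fixed r (by omega))
    have := a.decr r s (Fin.lt_def.2 (by omega)) hr (by omega)
    rw [Fin.lt_def] at this
    omega

theorem le_iff_prof {a b : PBWColumn n} : b ≤ a ↔ ∀ r, b.prof r ≤ a.prof r := by
  rw [le_def]
  constructor
  · rintro ⟨-, h⟩ r
    refine (b.prof_le_iff).2 fun s hs => ?_
    obtain ⟨t, ht, ht'⟩ := h s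
    have := a.le_prof (r := r) t (hs.trans ht)
    rw [Fin.le_def] at ht'
    omega
  · intro h
    refine ⟨?_, fun r => ?_⟩
    · by_contra hl
      have h1 := h a.len
      have h2 := b.len_le_prof (r := a.len) (by omega)
      rw [a.prof_eq_zero le_rfl] at h1
      omega
    · have h1 : (b.entry r : ℕ) < a.prof r := (b.le_prof r le_rfl).trans (h r)
      obtain ⟨s, hs, hs'⟩ := (a.lt_prof_iff).1 h1
      exact ⟨s, hs, by rw [Fin.le_def]; omega⟩

theorem prof_injective : Function.Injective (prof (n := n)) := by
  intro a b h
  have hl : a.len = b.len := by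
    by_contra hne
    rcases lt_or_gt_of_ne hne with hlt | hlt
    · have h1 := b.len_le_prof hlt
      rw [← h, a.prof_eq_zero le_rfl] at h1
      omega
    · have h1 := a.len_le_prof hlt
      rw [h, b.prof_eq_zero le_rfl] at h1
      omega
  have he : ∀ (r : ℕ) (ha : r < a.len) (hb : r < b.len), a.entry ⟨r, ha⟩ = b.entry ⟨r, hb⟩ := by
    intro r ha hb
    have h1 := a.entry_eq ⟨r, ha⟩
    have h2 := b.entry_eq ⟨r, hb⟩
    rw [h] at h1
    exact Fin.ext (h1.trans h2.symm)
  rcases a with ⟨k, _, _, f, _, _⟩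
  rcases b with ⟨l, _, _, g, _, _⟩
  obtain rfl : k = l := hl
  obtain rfl : f = g := funext fun r => he r r.2 r.2
  rfl

/-- The functions that occur as `prof`. -/
def IsProf (n : ℕ) (f : ℕ → ℕ) : Prop :=
  ∃ k, 1 ≤ k ∧ k < n ∧ Antitone f ∧ (∀ r, f r ≤ n) ∧ (∀ r < k, k ≤ f r) ∧ ∀ r, k ≤ r → f r = 0

theorem isProf_prof (a : PBWColumn n) : IsProf n a.prof :=
  ⟨a.len, a.len_pos, a.len_lt, a.prof_antitone, a.prof_le, fun _ => a.len_le_prof,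
    fun _ => a.prof_eq_zero⟩

theorem exists_prof_eq {f : ℕ → ℕ} (hf : IsProf n f) : ∃ a : PBWColumn n, a.prof = f := by
  obtain ⟨k, hk, hkn, hanti, hn, hlow, hzero⟩ := hf
  let a : PBWColumn n :=
    { len := k
      len_pos := hk
      len_lt := hkn
      entry := fun r => if f (r + 1) < f r then ⟨f r - 1, by have := hn r; omega⟩
        else ⟨r, r.2.trans hkn⟩
      fixed := by
        intro r h
        have h1 := hlow r r.2
        split_ifs at h ⊢ with hlt
        · simp only at h ⊢
          by_contra hne
          have h2 := hlow (r + 1) (by have := r.2; omega)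
          omega
        · rfl
      decr := by
        intro r s hrs h1 h2
        have := r.2
        have := s.2
        have h3 := hanti (show (r : ℕ) + 1 ≤ s from hrs)
        split_ifs at h1 h2 ⊢ with hr hs
        · rw [Fin.lt_def]
          simp only at h1 h2 ⊢
          omega
        all_goals simp only at h1 h2; omega }
  have hval : ∀ r : Fin k, (a.entry r : ℕ) = if f (r + 1) < f r then f r - 1 else (r : ℕ) := by
    intro r
    simp only [a]
    split_ifs <;> rfl
  refine ⟨a, funext fun r => ?_⟩
  have key : ∀ d r, k ≤ r + d → a.prof r = f r := by
    intro d
    induction d with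
    | zero => exact fun r hr => (a.prof_eq_zero hr).trans (hzero r hr).symm
    | succ d ih =>
      intro r hr
      by_cases hrk : r < k
      · have h1 := a.prof_succ ⟨r, hrk⟩
        have h2 := hval ⟨r, hrk⟩
        have h3 := hlow r hrk
        have h4 := hanti (Nat.le_succ r)
        simp only at h1 h2
        rw [ih (r + 1) (by omega)] at h1
        rw [h1, h2]
        simp only [Nat.succ_eq_add_one] at h4
        split_ifs with hlt
        · rw [max_eq_left] <;> omega
        · rw [max_eq_right] <;> omega
      · exact (a.prof_eq_zero (not_lt.1 hrk)).trans (hzero r (not_lt.1 hrk)).symm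
  exact key k r (Nat.le_add_left _ _)

theorem IsProf.sup {f g : ℕ → ℕ} (hf : IsProf n f) (hg : IsProf n g) :
    IsProf n fun r => max (f r) (g r) := by
  obtain ⟨k, hk, hkn, hanti, hn, hlow, hzero⟩ := hf
  obtain ⟨k', hk', hkn', hanti', hn', hlow', hzero'⟩ := hg
  refine ⟨max k k', by omega, by omega, fun r s h => max_le_max (hanti h) (hanti' h),
    fun r => max_le (hn r) (hn' r), fun r hr => ?_, fun r hr => ?_⟩
  · have h1 := hlow r
    have h2 := hlow' r
    rcases le_total k k' with h | h
    · exact (max_eq_right h).le.trans ((h2 (by omega)).trans (le_max_right _ _))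
    · exact (max_eq_left h).le.trans ((h1 (by omega)).trans (le_max_left _ _))
  · simp only [hzero r (by omega), hzero' r (by omega), max_self]

theorem IsProf.inf {f g : ℕ → ℕ} (hf : IsProf n f) (hg : IsProf n g) :
    IsProf n fun r => min (f r) (g r) := by
  obtain ⟨k, hk, hkn, hanti, hn, hlow, hzero⟩ := hf
  obtain ⟨k', hk', hkn', hanti', hn', hlow', hzero'⟩ := hg
  refine ⟨min k k', by omega, by omega, fun r s h => min_le_min (hanti h) (hanti' h),
    fun r => (min_le_left _ _).trans (hn r), fun r hr => ?_, fun r hr => ?_⟩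
  · exact min_le_min (hlow r (by omega)) (hlow' r (by omega))
  · rcases le_total k k' with h | h
    · simp only [hzero r (by omega), Nat.zero_min]
    · simp only [hzero' r (by omega), Nat.min_zero]

noncomputable instance : Max (PBWColumn n) where
  max a b := (exists_prof_eq (a.isProf_prof.sup b.isProf_prof)).choose

noncomputable instance : Min (PBWColumn n) where
  min a b := (exists_prof_eq (a.isProf_prof.inf b.isProf_prof)).choose

theorem prof_sup (a b : PBWColumn n) (r : ℕ) : (a ⊔ b).prof r = max (a.prof r) (b.prof r) :=
  congrFun (exists_prof_eq (a.isProf_prof.sup b.isProf_prof)).choose_spec r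

theorem prof_inf (a b : PBWColumn n) (r : ℕ) : (a ⊓ b).prof r = min (a.prof r) (b.prof r) :=
  congrFun (exists_prof_eq (a.isProf_prof.inf b.isProf_prof)).choose_spec r

/-- The PBW-semistandard columns form a distributive lattice under the order `≤` above. -/
noncomputable instance : DistribLattice (PBWColumn n) where
  le := (· ≤ ·)
  le_refl a := le_iff_prof.2 fun _ => le_rfl
  le_trans a b c h h' := le_iff_prof.2 fun r => (le_iff_prof.1 h r).trans (le_iff_prof.1 h' r)
  le_antisymm a b h h' :=
    prof_injective (funext fun r => le_antisymm (le_iff_prof.1 h r) (le_iff_prof.1 h' r))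
  sup := max
  inf := min
  le_sup_left a b := le_iff_prof.2 fun r => by rw [prof_sup]; exact le_max_left _ _
  le_sup_right a b := le_iff_prof.2 fun r => by rw [prof_sup]; exact le_max_right _ _
  sup_le a b c h h' := le_iff_prof.2 fun r => by
    rw [prof_sup]; exact max_le (le_iff_prof.1 h r) (le_iff_prof.1 h' r)
  inf_le_left a b := le_iff_prof.2 fun r => by rw [prof_inf]; exact min_le_left _ _
  inf_le_right a b := le_iff_prof.2 fun r => by rw [prof_inf]; exact min_le_right _ _
  le_inf a b c h h' := le_iff_prof.2 fun r => by
    rw [prof_inf]; exact le_min (le_iff_prof.1 h r) (le_iff_prof.1 h' r)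
  le_sup_inf a b c := le_iff_prof.2 fun r => by
    simp only [prof_sup, prof_inf]; exact (max_min_distrib_left _ _ _).ge

instance : Finite (PBWColumn n) := by
  refine Finite.of_injective
    (fun a => (⟨⟨a.len, a.len_lt⟩, a.entry⟩ : Σ k : Fin n, Fin k → Fin n)) ?_
  rintro ⟨k, _, _, f, _, _⟩ ⟨l, _, _, g, _, _⟩ h
  simp only [Sigma.mk.injEq, Fin.mk.injEq] at h
  obtain ⟨rfl, h⟩ := h
  obtain rfl := eq_of_heq h
  rfl

/-- The set `V_o` of the columns `(1, …, k)` with `2 ≤ k ≤ n - 1`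
(`V_c` consists of the other join-irreducible columns). -/
def orderPart (n : ℕ) : Set (PBWColumn n) :=
  {c | 2 ≤ c.len ∧ ∀ r, (c.entry r : ℕ) = r}

end PBWColumn

/-! ### The operation `⊙` of an interpolating polytope -/

section Odot

variable {L : Type*} [DistribLattice L]

/-- `ι a`: the order ideal of the join-irreducible elements below `a`. -/
def irredIdeal (a : L) : Set L := {p | SupIrred p ∧ p ≤ a}

/-- `K_{U_o,U_c}(J)`, for an order ideal `J` of join-irreducible elements: all elements of
`J ∩ U_o`, and those elements of `J ∩ U_c` that are maximal in `J`. -/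
def interpSet (Uo J : Set L) : Set L := {p | p ∈ J ∧ (p ∈ Uo ∨ ∀ q ∈ J, ¬ p < q)}

/-- `c = a ⊙ b`: the sum of the indicator functions of `K(ι a)` and `K(ι b)` is the sum of the
indicator functions of `K(ι a ∪ ι b)` and `K(ι c)`. -/
def IsOdot (Uo : Set L) (a b c : L) : Prop :=
  (interpSet Uo (irredIdeal a)).indicator (1 : L → ℕ) +
      (interpSet Uo (irredIdeal b)).indicator (1 : L → ℕ) =
    (interpSet Uo (irredIdeal a ∪ irredIdeal b)).indicator (1 : L → ℕ) +
      (interpSet Uo (irredIdeal c)).indicator (1 : L → ℕ)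

/-- In a finite distributive lattice, `a ⊙ b` is uniquely determined. -/
theorem IsOdot.unique [Finite L] {Uo : Set L} {a b c d : L} (hc : IsOdot Uo a b c)
    (hd : IsOdot Uo a b d) : c = d := by
  have hK : interpSet Uo (irredIdeal c) = interpSet Uo (irredIdeal d) :=
    Set.indicator_one_inj ℕ (add_left_cancel (hc.symm.trans hd))
  have key : ∀ x y : L, interpSet Uo (irredIdeal x) = interpSet Uo (irredIdeal y) → x ≤ y := by
    intro x y h
    have : Nonempty L := ⟨x⟩
    have := Fintype.ofFinite L
    let _ : OrderBot L := Fintype.toOrderBot L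
    obtain ⟨s, rfl, hs⟩ := exists_supIrred_decomposition x
    refine Finset.sup_le fun p hp => ?_
    obtain ⟨q, hpq, hq⟩ := (Set.toFinite (irredIdeal (s.sup id))).exists_le_maximal
      (show p ∈ irredIdeal (s.sup id) from ⟨hs hp, Finset.le_sup (f := id) hp⟩)
    have hq' : q ∈ interpSet Uo (irredIdeal (s.sup id)) :=
      ⟨hq.1, Or.inr fun r hr hlt => (hq.2 hr hlt.le).not_gt hlt⟩
    rw [h] at hq'
    exact hpq.trans hq'.1.2
  exact le_antisymm (key c d hK) (key d c hK.symm)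

end Odot

/-! ### The Plücker ideal -/

section Pluecker

open MvPolynomial

/-- The ring of polynomials in the Plücker variables `X_b`, one for each PBW-semistandard column
`b = (α₁, …, α_k)`; the variable `X_b` is `X_{α₁,…,α_k}`, which is alternating in its indices. -/
abbrev PlueckerRing (n : ℕ) : Type := MvPolynomial (PBWColumn n) ℂ

/-- The Plücker coordinate with index `b = (α₁, …, α_k)` of a square matrix `z`: the determinant of
the `k × k` matrix with entries `z_{i, α_j}`. -/
def plueckerCoord {A : Type*} [CommRing A] {n : ℕ} (z : Matrix (Fin n) (Fin n) A)
    (b : PBWColumn n) : A :=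
  (z.submatrix (Fin.castLE b.len_lt.le) b.entry).det

/-- The ideal of Plücker relations: all polynomial relations between the Plücker coordinates of a
generic `n × n` matrix. -/
noncomputable def plueckerIdeal (n : ℕ) : Ideal (PlueckerRing n) :=
  RingHom.ker (aeval (R := ℂ) (plueckerCoord (Matrix.mvPolynomialX (Fin n) (Fin n) ℂ))).toRingHom

/-- Equivalently, it is the vanishing ideal of (the multicone over) the variety of complete flags
in its Plücker embedding. -/
theorem mem_plueckerIdeal_iff {n : ℕ} {p : PlueckerRing n} :
    p ∈ plueckerIdeal n ↔
      ∀ g : Matrix (Fin n) (Fin n) ℂ, IsUnit g.det → eval (plueckerCoord g) p = 0 := by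
  set Z := Matrix.mvPolynomialX (Fin n) (Fin n) ℂ with hZ
  have hev : ∀ x : Fin n × Fin n → ℂ, eval x (aeval (R := ℂ) (plueckerCoord Z) p) =
      eval (plueckerCoord (Matrix.of fun i j => x (i, j))) p := by
    intro x
    have h1 : ((eval x).comp (aeval (R := ℂ) (plueckerCoord Z)).toRingHom) =
        eval (plueckerCoord (Matrix.of fun i j => x (i, j))) := by
      refine MvPolynomial.ringHom_ext (fun r => by simp) fun b => ?_
      simp only [RingHom.comp_apply, AlgHom.toRingHom_eq_coe, RingHom.coe_coe, aeval_X, eval_X,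
        plueckerCoord]
      rw [RingHom.map_det]
      congr 1
      ext i j
      simp [hZ, Matrix.mvPolynomialX]
    exact DFunLike.congr_fun h1 p
  have hdet : ∀ x : Fin n × Fin n → ℂ,
      eval x Z.det = (Matrix.of fun i j => x (i, j)).det := by
    intro x
    rw [RingHom.map_det]
    congr 1
    ext i j
    simp [hZ, Matrix.mvPolynomialX]
  have hmem : p ∈ plueckerIdeal n ↔ aeval (R := ℂ) (plueckerCoord Z) p = 0 := Iff.rfl
  rw [hmem]
  constructor
  · intro h g _
    have := hev fun ij => g ij.1 ij.2
    rw [h, map_zero] at this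
    exact this.symm
  · intro h
    have h0 : aeval (R := ℂ) (plueckerCoord Z) p * Z.det = 0 := by
      refine MvPolynomial.funext fun x => ?_
      rw [map_mul, hev, hdet, map_zero]
      by_cases hx : IsUnit (Matrix.of fun i j => x (i, j)).det
      · rw [h _ hx, zero_mul]
      · rw [isUnit_iff_ne_zero, not_not] at hx
        rw [hx, mul_zero]
    exact (mul_eq_zero.1 h0).resolve_right (Matrix.det_mvPolynomialX_ne_zero (Fin n) ℂ)

end Pluecker

/-! ### Straightening relations and algebras with straightening laws -/

/-- A monomial, given by its exponents, is standard if its factors are pairwise comparable. -/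
def IsStandardMonomial {Ω : Type*} [PartialOrder Ω] (d : Ω →₀ ℕ) : Prop :=
  ∀ a ∈ d.support, ∀ b ∈ d.support, a ≤ b ∨ b ≤ a

/-- `p` is a straightening relation for `X_a X_b` modulo the ideal `I`: an element of `I` of the
form `X_a X_b + Q`, with `Q` a linear combination of standard monomials. -/
def IsStraighteningRelation {Ω : Type*} [PartialOrder Ω] (I : Ideal (MvPolynomial Ω ℂ))
    (a b : Ω) (p : MvPolynomial Ω ℂ) : Prop :=
  p ∈ I ∧ ∀ d ∈ (p - MvPolynomial.X a * MvPolynomial.X b).support, IsStandardMonomial d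

/-- The commutative algebra `A` is an algebra with straightening laws on the finite poset `Ω` with
respect to the map `ε`. Weak chains `ω₁ ≤ … ≤ ω_m` are encoded by their multiplicities. -/
structure IsASL {Ω : Type*} [PartialOrder Ω] [Finite Ω] {A : Type*} [CommRing A] [Algebra ℂ A]
    (ε : Ω → A) : Prop where
  injective : Function.Injective ε
  /-- the standard monomials are linearly independent … -/
  linearIndependent : LinearIndependent ℂ
    fun d : {d : Ω →₀ ℕ // IsStandardMonomial d} => d.1.prod fun ω k => ε ω ^ k
  /-- … and span `A` -/
  span_eq_top : Submodule.span ℂ (Set.range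
    fun d : {d : Ω →₀ ℕ // IsStandardMonomial d} => d.1.prod fun ω k => ε ω ^ k) = ⊤
  /-- in the representation of `ε χ₁ * ε χ₂`, for incomparable `χ₁`, `χ₂`, as a linear combination
  of standard monomials, each monomial `ε ω₁ ⋯ ε ω_m` with `ω₁ ≤ … ≤ ω_m` that occurs satisfies
  `m ≥ 1`, `ω₁ ≤ χ₁` and `ω₁ ≤ χ₂` -/
  straightening : ∀ χ₁ χ₂ : Ω, ¬ χ₁ ≤ χ₂ → ¬ χ₂ ≤ χ₁ →
    ∀ c : {d : Ω →₀ ℕ // IsStandardMonomial d} →₀ ℂ,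
      ε χ₁ * ε χ₂ = (c.sum fun d x => x • d.1.prod fun ω k => ε ω ^ k) →
      ∀ d ∈ c.support, ∃ ω₁ ∈ d.1.support, (∀ ω ∈ d.1.support, ω₁ ≤ ω) ∧ ω₁ ≤ χ₁ ∧ ω₁ ≤ χ₂

/-! A column is encoded by its profile, the largest letter at or below each position; the order is
the pointwise order of profiles. By `lt_prof_iff_card_entries` the profile depends only on the set
of letters, so columns correspond to nonempty proper subsets of the alphabet.

Spanning. If `b ≤ a` fails at position `r`, a Garnir relation alternates the letters of `a` from `r`
downwards with those of `b` down to `r`. Every nontrivial exchange lowers the profile of `b`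
lexicographically, so products of two Plücker coordinates reduce to standard ones with the same
multiset of letters.

Independence. On the matrix `triMatrix` each Plücker coordinate has a diagonal term dividing all its
other terms (`hasLead_plueckerCoord`). The support of its exponent is the region under the profile.
Hence the exponent of a standard monomial reveals its greatest factor, and, by peeling, the whole
monomial.

Shape. Since leading terms divide, each standard term `X_g X_h` in the expansion of `X_a X_b` has
exponent at least that of `X_a X_b`, which forces `a ⊔ b ≤ h`. Exactly one term attains equality,
with coefficient 1. For it `h = a ⊔ b`, and second differences of exponents give `g = a ⊙ b`
(`isOdot_of_leadExp_add_eq`). Any other term with `h = a ⊔ b` is excluded by the multiset of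
letters. The bound `g ≤ a ⊓ b` is the join bound carried through the order-reversing duality that
replaces a minor by a complementary minor of the inverse matrix (`le_inf_of_mem_support`).

Generation follows because straightening raises a bounded weight, minimality by comparing
coefficients in degree two, and the straightening law from the bound on `g`. -/

namespace PBWColumn

variable {n : ℕ}

/-! ### Profiles and sets of letters -/

theorem lt_prof_iff_exists_le (a : PBWColumn n) {s m : ℕ} :
    m < a.prof s ↔ ∃ c : Fin a.len, s ≤ c ∧ m ≤ (a.entry c : ℕ) := by
  simp only [lt_prof_iff, Nat.lt_succ_iff]

theorem entry_injective (a : PBWColumn n) : Function.Injective a.entry := by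
  have key : ∀ r s, r < s → a.entry r ≠ a.entry s := by
    intro r s hrs h
    by_cases hr : (a.entry r : ℕ) < a.len
    · have h1 := a.fixed r hr
      have h2 := a.fixed s (h ▸ hr)
      rw [Fin.lt_def] at hrs
      rw [h] at h1
      omega
    · exact (a.decr r s hrs (by omega) (by rw [← h]; omega)).ne' h
  intro r s h
  rcases lt_trichotomy r s with hlt | rfl | hlt
  · exact (key r s hlt h).elim
  · rfl
  · exact (key s r hlt h.symm).elim

theorem card_filter_le_val (k s : ℕ) :
    (Finset.univ.filter fun c : Fin k => s ≤ (c : ℕ)).card = k - s := by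
  have h := Finset.card_image_of_injective (Finset.univ.filter fun c : Fin k => s ≤ (c : ℕ))
    Fin.val_injective
  rw [← h, show (Finset.univ.filter fun c : Fin k => s ≤ (c : ℕ)).image Fin.val = Finset.Ico s k by
    ext x
    simp only [Finset.mem_image, Finset.mem_filter, Finset.mem_univ, true_and, Finset.mem_Ico]
    exact ⟨by rintro ⟨c, hc, rfl⟩; exact ⟨hc, c.2⟩, fun h => ⟨⟨x, h.2⟩, h.1, rfl⟩⟩, Nat.card_Ico]

/-- A letter below a bound attained at or below position `s` cannot stand above position `s`. -/
theorem le_pos_of_lt_prof (a : PBWColumn n) {s m : ℕ} (h : m < a.prof s) (c : Fin a.len)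
    (h1 : s ≤ (a.entry c : ℕ)) (h2 : (a.entry c : ℕ) < m) : s ≤ (c : ℕ) := by
  obtain ⟨c', hc', hm⟩ := a.lt_prof_iff_exists_le.1 h
  by_contra hc
  have hlen : a.len ≤ (a.entry c : ℕ) := by
    by_contra hl
    have := a.fixed c (by omega)
    omega
  have := a.decr c c' (Fin.lt_def.2 (by omega)) hlen (by omega)
  rw [Fin.lt_def] at this
  omega

/-- Every letter from position `s` downwards is at least `s`. If one of them is at least `m`, then
all letters in `[s, m)` also lie at positions at least `s`, leaving at least one of the `a.len - s`
positions for a larger letter. The criterion no longer mentions positions of letters, so profiles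
can be computed from unordered sets. -/
theorem lt_prof_iff_card (a : PBWColumn n) {s m : ℕ} :
    m < a.prof s ↔
      s + (Finset.univ.filter fun c => s ≤ (a.entry c : ℕ) ∧ (a.entry c : ℕ) < m).card < a.len := by
  constructor
  · intro h
    obtain ⟨c', hc', hm⟩ := a.lt_prof_iff_exists_le.1 h
    have h1 : (Finset.univ.filter fun c => s ≤ (a.entry c : ℕ) ∧ (a.entry c : ℕ) < m) ⊂
        Finset.univ.filter fun c : Fin a.len => s ≤ (c : ℕ) := by
      refine (Finset.ssubset_iff_of_subset fun c hc => ?_).2 ⟨c', by simpa using hc', by simp [hm]⟩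
      simp only [Finset.mem_filter, Finset.mem_univ, true_and] at hc ⊢
      exact a.le_pos_of_lt_prof h c hc.1 hc.2
    have h2 := Finset.card_lt_card h1
    rw [card_filter_le_val] at h2
    omega
  · intro h
    by_contra hm
    have h1 : (Finset.univ.filter fun c : Fin a.len => s ≤ (c : ℕ)) ⊆
        Finset.univ.filter fun c => s ≤ (a.entry c : ℕ) ∧ (a.entry c : ℕ) < m := by
      intro c hc
      simp only [Finset.mem_filter, Finset.mem_univ, true_and] at hc ⊢
      refine ⟨hc.trans (a.le_entry c), ?_⟩
      by_contra hc'
      exact hm (a.lt_prof_iff_exists_le.2 ⟨c, hc, by omega⟩)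
    have h2 := Finset.card_le_card h1
    rw [card_filter_le_val] at h2
    omega

/-- The set of entries of a column. -/
def entries (a : PBWColumn n) : Finset (Fin n) := Finset.univ.image a.entry

theorem mem_entries (a : PBWColumn n) {x : Fin n} : x ∈ a.entries ↔ ∃ c, a.entry c = x := by
  simp [entries]

theorem card_entries (a : PBWColumn n) : a.entries.card = a.len := by
  simp [entries, Finset.card_image_of_injective _ a.entry_injective]

theorem card_filter_entries (a : PBWColumn n) (p : Fin n → Prop) [DecidablePred p] :
    (Finset.univ.filter fun c => p (a.entry c)).card = (a.entries.filter p).card := by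
  rw [entries, Finset.filter_image, Finset.card_image_of_injective _ a.entry_injective]

theorem lt_prof_iff_card_entries (a : PBWColumn n) {s m : ℕ} :
    m < a.prof s ↔
      s + (a.entries.filter fun x : Fin n => s ≤ (x : ℕ) ∧ (x : ℕ) < m).card < a.len := by
  rw [lt_prof_iff_card, card_filter_entries a fun x : Fin n => s ≤ (x : ℕ) ∧ (x : ℕ) < m]

theorem eq_of_lt_prof_iff {a b : PBWColumn n} (h : ∀ s m, m < a.prof s ↔ m < b.prof s) : a = b :=
  prof_injective (funext fun s => eq_of_forall_lt_iff fun m => h s m)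

theorem le_iff_lt_prof {a b : PBWColumn n} : a ≤ b ↔ ∀ s m, m < a.prof s → m < b.prof s := by
  rw [le_iff_prof]
  exact ⟨fun h s m hm => hm.trans_le (h s), fun h s => le_of_forall_lt fun m => h s m⟩

theorem entries_injective : Function.Injective (entries (n := n)) := by
  intro a b h
  refine eq_of_lt_prof_iff fun s m => ?_
  rw [lt_prof_iff_card_entries, lt_prof_iff_card_entries, ← card_entries a, ← card_entries b, h]

/-- With `k` letters in `S`, those below `k` must occupy their own positions. The free positions `F`
are as many as the remaining letters `B`, which fill them in decreasing order. -/
theorem exists_entries_eq (S : Finset (Fin n)) (h0 : S.Nonempty) (hn : S.card < n) :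
    ∃ a : PBWColumn n, a.entries = S := by
  classical
  set k := S.card with hk
  let B : Finset (Fin n) := S.filter fun x : Fin n => k ≤ (x : ℕ)
  let F : Finset (Fin k) := Finset.univ.filter fun r => Fin.castLE hn.le r ∉ S
  have hBF : B.card = F.card := by
    have h1 := Finset.card_filter_add_card_filter_not (s := S) (fun x : Fin n => k ≤ (x : ℕ))
    have h2 := Finset.card_filter_add_card_filter_not (s := (Finset.univ : Finset (Fin k)))
      (fun r => Fin.castLE hn.le r ∉ S)
    have h3 : (S.filter fun x : Fin n => ¬ k ≤ (x : ℕ)).card =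
        (Finset.univ.filter fun r : Fin k => ¬ Fin.castLE hn.le r ∉ S).card := by
      rw [← Finset.card_image_of_injective (Finset.univ.filter fun r : Fin k =>
        ¬ Fin.castLE hn.le r ∉ S) (Fin.castLE_injective hn.le)]
      refine congrArg Finset.card ?_
      ext x
      simp only [Finset.mem_filter, Finset.mem_image, Finset.mem_univ, true_and, not_not, not_le]
      constructor
      · exact fun h => ⟨⟨x, h.2⟩, by simpa using h.1, by ext; rfl⟩
      · rintro ⟨r, hr, rfl⟩
        exact ⟨hr, r.2⟩
    simp only [Finset.card_univ, Fintype.card_fin] at h2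
    change (S.filter _).card = (Finset.univ.filter _).card
    omega
  let eB := B.orderIsoOfFin rfl
  let eF := F.orderIsoOfFin hBF.symm
  let f : Fin k → Fin n := fun r =>
    if h : r ∈ F then eB (Fin.rev (eF.symm ⟨r, h⟩)) else Fin.castLE hn.le r
  have hf1 : ∀ r, ∀ h : r ∈ F, f r = eB (Fin.rev (eF.symm ⟨r, h⟩)) := fun r h => dif_pos h
  have hf2 : ∀ r, r ∉ F → f r = Fin.castLE hn.le r := fun r h => dif_neg h
  have hB : ∀ r ∈ F, k ≤ (f r : ℕ) := by
    intro r h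
    rw [hf1 r h]
    exact (Finset.mem_filter.1 (eB (Fin.rev (eF.symm ⟨r, h⟩))).2).2
  have hfS : ∀ r, f r ∈ S := by
    intro r
    by_cases h : r ∈ F
    · rw [hf1 r h]
      exact (Finset.mem_filter.1 (eB (Fin.rev (eF.symm ⟨r, h⟩))).2).1
    · rw [hf2 r h]
      simpa [F] using h
  have hmemF : ∀ r, k ≤ (f r : ℕ) → r ∈ F := by
    intro r h
    by_contra hr
    rw [hf2 r hr] at h
    have := r.2
    simp only [Fin.val_castLE] at h
    omega
  let a : PBWColumn n :=
    { len := k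
      len_pos := Finset.card_pos.2 h0
      len_lt := hn
      entry := f
      fixed := by
        intro r h
        rw [hf2 r fun hr => by have := hB r hr; omega]
        rfl
      decr := by
        intro r s hrs h1 h2
        rw [hf1 r (hmemF r h1), hf1 s (hmemF s h2), Subtype.coe_lt_coe, eB.lt_iff_lt,
          Fin.rev_lt_rev, eF.symm.lt_iff_lt]
        exact hrs }
  refine ⟨a, Finset.eq_of_subset_of_card_le (fun x hx => ?_) a.card_entries.ge⟩
  obtain ⟨c, rfl⟩ := a.mem_entries.1 hx
  exact hfS c

end PBWColumn

/-! ### The weight decreased by Garnir exchanges -/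

namespace PBWColumn

variable {n : ℕ}

/-- A weight that is monotone for the lexicographic order of profiles read from the bottom. -/
def profWeight (a : PBWColumn n) : ℕ := ∑ s ∈ Finset.range n, a.prof s * (n + 1) ^ s

/-- Profile values are at most `n`, hence digits in base `n + 1`; a gain in digit `r` outweighs any
loss in the digits below it. -/
theorem profWeight_lt {a b : PBWColumn n} {r : ℕ} (hr : a.prof r < b.prof r)
    (h : ∀ s, r < s → a.prof s ≤ b.prof s) : a.profWeight < b.profWeight := by
  have hrn : r < n := by
    by_contra hc
    have := b.prof_eq_zero (r := r) (by have := b.len_lt; omega)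
    omega
  have hlow : ∀ t, ∑ s ∈ Finset.range t, a.prof s * (n + 1) ^ s < (n + 1) ^ t := by
    intro t
    induction t with
    | zero => simp
    | succ t ih =>
      rw [Finset.sum_range_succ, pow_succ]
      have := Nat.mul_le_mul_right ((n + 1) ^ t) (a.prof_le t)
      nlinarith
  have hsplit : ∀ c : PBWColumn n, c.profWeight = ∑ s ∈ Finset.range r, c.prof s * (n + 1) ^ s +
      c.prof r * (n + 1) ^ r + ∑ s ∈ Finset.Ico (r + 1) n, c.prof s * (n + 1) ^ s := by
    intro c
    rw [profWeight, ← Finset.sum_range_succ, Finset.sum_range_add_sum_Ico _ (by omega)]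
  rw [hsplit, hsplit]
  have h1 := hlow r
  have h2 : ∑ s ∈ Finset.Ico (r + 1) n, a.prof s * (n + 1) ^ s ≤
      ∑ s ∈ Finset.Ico (r + 1) n, b.prof s * (n + 1) ^ s :=
    Finset.sum_le_sum fun s hs => Nat.mul_le_mul_right _ (h s (Finset.mem_Ico.1 hs).1)
  have h3 := Nat.mul_le_mul_right ((n + 1) ^ r) (Nat.succ_le_of_lt hr)
  rw [Nat.succ_mul] at h3
  omega

theorem lt_prof_iff_card_of_image (a : PBWColumn n) {k : ℕ} {γ : Fin k → Fin n}
    (hγ : Function.Injective γ) (hlen : a.len = k) (ha : a.entries = Finset.univ.image γ)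
    {s m : ℕ} : m < a.prof s ↔
      s + (Finset.univ.filter fun c => s ≤ (γ c : ℕ) ∧ (γ c : ℕ) < m).card < k := by
  rw [lt_prof_iff_card_entries, ha, Finset.filter_image, Finset.card_image_of_injective _ hγ, hlen]

/-- The effect on profiles of the exchanges in a Garnir relation. -/
theorem profWeight_lt_of_exchange (b b' : PBWColumn n) (r : Fin b.len) (hM : b.len ≤ b.entry r)
    {γ : Fin b.len → Fin n} (hγ : Function.Injective γ) (hlen : b'.len = b.len)
    (hb' : b'.entries = Finset.univ.image γ) (heq : ∀ c, r < c → γ c = b.entry c)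
    (hex : ∃ c, c ≤ r ∧ (r : ℕ) ≤ γ c ∧ γ c < b.entry r) : b'.profWeight < b.profWeight := by
  have hlow : ∀ c, r < c → b.entry c < b.entry r := by
    intro c hc
    by_cases hcl : b.len ≤ (b.entry c : ℕ)
    · exact b.decr r c hc hM hcl
    · rw [Fin.lt_def]
      omega
  have hhigh : ∀ c, c ≤ r → (r : ℕ) ≤ b.entry c → b.entry r ≤ b.entry c := by
    intro c hc hrc
    rcases hc.eq_or_lt with rfl | hc
    · exact le_rfl
    · by_cases hcl : b.len ≤ (b.entry c : ℕ)
      · exact (b.decr c r hc hcl hM).le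
      · have := b.fixed c (by omega)
        rw [Fin.lt_def] at hc
        omega
  -- By `hhigh`, the positions of `b` up to `r` hold no letter of `[s, m)`, and the later positions
  -- are unchanged. So passing to `γ` can only increase the count in the cardinality criterion,
  -- which can only destroy inequalities `m < prof s`.
  have hsmall : ∀ s m : ℕ, (r : ℕ) ≤ s → m ≤ b.entry r → m < b'.prof s → m < b.prof s := by
    intro s m hs hm h
    rw [b'.lt_prof_iff_card_of_image hγ hlen hb'] at h
    rw [b.lt_prof_iff_card]
    refine lt_of_le_of_lt (Nat.add_le_add_left (Finset.card_le_card fun c hc => ?_) s) h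
    simp only [Finset.mem_filter, Finset.mem_univ, true_and] at hc ⊢
    rcases le_or_gt c r with hcr | hcr
    · have := hhigh c hcr (hs.trans hc.1)
      rw [Fin.le_def] at this
      omega
    · rwa [heq c hcr]
  refine profWeight_lt (r := r) ?_ fun s hs => le_of_forall_lt fun m hm => ?_
  · have h1 : (b.entry r : ℕ) + 1 ≤ b.prof r := b.le_prof r le_rfl
    refine lt_of_lt_of_le (Nat.lt_succ_of_le (not_lt.1 fun h => ?_)) h1
    rw [b'.lt_prof_iff_card_of_image hγ hlen hb'] at h
    obtain ⟨c₀, hc₀, hrc, hcr⟩ := hex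
    -- The letters after position `r` all lie in `[r, b.entry r)`, and the exchanged letter at `c₀`
    -- is one more: together `b.len - r` of them, one too many for `b.entry r < b'.prof r`.
    have hsub : insert c₀ (Finset.univ.filter fun c : Fin b.len => (r : ℕ) + 1 ≤ (c : ℕ)) ⊆
        Finset.univ.filter fun c => (r : ℕ) ≤ (γ c : ℕ) ∧ (γ c : ℕ) < b.entry r := by
      intro c hc
      simp only [Finset.mem_insert, Finset.mem_filter, Finset.mem_univ, true_and] at hc ⊢
      rcases hc with rfl | hc
      · exact ⟨hrc, hcr⟩
      · rw [heq c (Fin.lt_def.2 hc)]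
        have := b.le_entry c
        exact ⟨by omega, hlow c (Fin.lt_def.2 hc)⟩
    have h2 := Finset.card_le_card hsub
    rw [Finset.card_insert_of_notMem, card_filter_le_val] at h2
    · have := r.2
      omega
    · rw [Fin.le_def] at hc₀
      simp only [Finset.mem_filter, Finset.mem_univ, true_and]
      omega
  · by_cases hmr : m ≤ b.entry r
    · exact hsmall s m hs.le hmr hm
    · have h1 := hsmall s (b.entry r) hs.le le_rfl (by omega)
      obtain ⟨c, hc, hc'⟩ := b.lt_prof_iff_exists_le.1 h1
      have := hlow c (Fin.lt_def.2 (by omega))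
      rw [Fin.lt_def] at this
      omega

end PBWColumn

/-! ### Garnir relations between minors -/

section Garnir

variable {A : Type*} [CommRing A] {n : ℕ}

/-- The product of two minors on the first rows, as a multilinear map in all the columns. -/
noncomputable def minorProd (A : Type*) [CommRing A] (k l : ℕ) (h : l ≤ k) :
    MultilinearMap A (fun _ : Fin k ⊕ Fin l => Fin k → A) A :=
  (LinearMap.mul' A A).compMultilinearMap
    (MultilinearMap.domCoprod (Matrix.detRowAlternating (R := A) (n := Fin k)).toMultilinearMap
      ((Matrix.detRowAlternating (R := A) (n := Fin l)).compLinearMap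
        (LinearMap.funLeft A A (Fin.castLE h))).toMultilinearMap)

/-- Both minors are read off the same vectors of `A^k`, the smaller one using only the first `l`
coordinates; this puts all columns on an equal footing for alternation. -/
theorem minorProd_apply (z : Matrix (Fin n) (Fin n) A) {k l : ℕ} (h : l ≤ k) (hk : k ≤ n)
    (v : Fin k ⊕ Fin l → Fin n) :
    minorProd A k l h (fun i j => z (Fin.castLE hk j) (v i)) =
      (z.submatrix (Fin.castLE hk) fun c => v (Sum.inl c)).det *
        (z.submatrix (Fin.castLE (h.trans hk)) fun c => v (Sum.inr c)).det := by
  rw [← Matrix.det_transpose, ← Matrix.det_transpose (z.submatrix (Fin.castLE (h.trans hk)) _)]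
  rfl

/-- More than `k` vectors in `A^k` are linearly dependent, so an alternating map in them vanishes.
-/
theorem garnir_relation [IsDomain A] (z : Matrix (Fin n) (Fin n) A) {k l : ℕ} (h : l ≤ k)
    (hk : k ≤ n) (v : Fin k ⊕ Fin l → Fin n) (P : Fin k ⊕ Fin l → Prop) [DecidablePred P]
    (hP : k < Fintype.card {i // P i}) :
    ∑ σ : Equiv.Perm {i // P i}, Equiv.Perm.sign σ •
      ((z.submatrix (Fin.castLE hk) fun c => v (Equiv.Perm.ofSubtype σ (Sum.inl c))).det *
        (z.submatrix (Fin.castLE (h.trans hk))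
          fun c => v (Equiv.Perm.ofSubtype σ (Sum.inr c))).det) = 0 := by
  let w : Fin k ⊕ Fin l → Fin k → A := fun i j => z (Fin.castLE hk j) (v i)
  have h0 : MultilinearMap.alternatization
      ((minorProd A k l h).domDomRestrict P fun i => w i) (fun i => w i) = 0 := by
    refine AlternatingMap.map_linearDependent _ _ fun hli => ?_
    have := hli.fintype_card_le_finrank
    rw [Module.finrank_fintype_fun_eq_card, Fintype.card_fin] at this
    omega
  rw [MultilinearMap.alternatization_apply] at h0
  rw [← h0]
  refine Finset.sum_congr rfl fun σ _ => ?_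
  rw [MultilinearMap.domDomCongr_apply, MultilinearMap.domDomRestrict_apply,
    ← minorProd_apply z h hk fun i => v (Equiv.Perm.ofSubtype σ i)]
  congr 2
  funext i
  split_ifs with hi
  · simp only [w, Equiv.Perm.ofSubtype_apply_of_mem σ hi]
  · simp only [w, Equiv.Perm.ofSubtype_apply_of_not_mem σ hi]

end Garnir

section Minors

variable {A : Type*} [CommRing A] {n : ℕ}

theorem exists_plueckerCoord_of_injective (z : Matrix (Fin n) (Fin n) A) {k : ℕ} (hk : 0 < k)
    (hkn : k < n) {γ : Fin k → Fin n} (hγ : Function.Injective γ) :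
    ∃ (c : PBWColumn n) (ε : ℤˣ), c.len = k ∧ c.entries = Finset.univ.image γ ∧
      (z.submatrix (Fin.castLE hkn.le) γ).det = ε • plueckerCoord z c := by
  have hcard : (Finset.univ.image γ).card = k := by
    rw [Finset.card_image_of_injective _ hγ, Finset.card_univ, Fintype.card_fin]
  obtain ⟨c, hc⟩ := PBWColumn.exists_entries_eq (Finset.univ.image γ)
    (Finset.card_pos.1 (hcard.symm ▸ hk)) (hcard.symm ▸ hkn)
  have hlen : c.len = k := by rw [← c.card_entries, hc, hcard]
  subst hlen
  have hex : ∀ i, ∃ j, c.entry j = γ i := fun i => c.mem_entries.1 (by simp [hc])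
  choose π hπ using hex
  have hinj : Function.Injective π := fun i j h => hγ (by rw [← hπ, ← hπ, h])
  let e : Equiv.Perm (Fin c.len) := Equiv.ofBijective π (Finite.injective_iff_bijective.1 hinj)
  refine ⟨c, Equiv.Perm.sign e, rfl, hc, ?_⟩
  have h1 : z.submatrix (Fin.castLE hkn.le) γ =
      (z.submatrix (Fin.castLE hkn.le) c.entry).submatrix id e := by
    ext i j
    simp [e, hπ]
  rw [h1, Matrix.det_permute', Units.smul_def, zsmul_eq_mul]
  rfl

theorem minor_eq_zero (z : Matrix (Fin n) (Fin n) A) {k : ℕ} (hkn : k ≤ n) {γ : Fin k → Fin n}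
    (hγ : ¬ Function.Injective γ) : (z.submatrix (Fin.castLE hkn) γ).det = 0 := by
  simp only [Function.Injective, not_forall] at hγ
  obtain ⟨i, j, h, hij⟩ := hγ
  exact Matrix.det_zero_of_column_eq hij fun x => by simp [h]

end Minors

/-! ### Straightening a product of two Plücker coordinates -/

section QuadraticSpanning

variable {A : Type*} [CommRing A] [IsDomain A] [Algebra ℂ A] {n : ℕ}

open Equiv.Perm in
/-- One step of the straightening of a product of two Plücker coordinates. -/
theorem plueckerCoord_mul_mem_span_exchange (z : Matrix (Fin n) (Fin n) A) (a b : PBWColumn n)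
    (hlen : b.len ≤ a.len) (hab : ¬ b ≤ a) :
    plueckerCoord z a * plueckerCoord z b ∈ Submodule.span ℂ
      {x | ∃ a' b' : PBWColumn n, a'.len = a.len ∧ b'.len = b.len ∧
        a'.entries.val + b'.entries.val = a.entries.val + b.entries.val ∧
        b'.profWeight < b.profWeight ∧ x = plueckerCoord z a' * plueckerCoord z b'} := by
  classical
  set W := Submodule.span ℂ
      {x | ∃ a' b' : PBWColumn n, a'.len = a.len ∧ b'.len = b.len ∧
        a'.entries.val + b'.entries.val = a.entries.val + b.entries.val ∧
        b'.profWeight < b.profWeight ∧ x = plueckerCoord z a' * plueckerCoord z b'} with hW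
  obtain ⟨r, hr⟩ : ∃ r : Fin b.len, ∀ s : Fin a.len, (r : ℕ) ≤ s → a.entry s < b.entry r := by
    rw [PBWColumn.le_def] at hab
    push Not at hab
    exact hab hlen
  -- A letter of `b` not exceeding its length would be `r` itself, and position `r` of `a` already
  -- holds a letter at least `r`.
  have hM : b.len ≤ b.entry r := by
    by_contra hc
    have h1 := b.fixed r (by omega)
    have h2 := hr ⟨r, by omega⟩ le_rfl
    have h3 := a.le_entry ⟨r, by omega⟩
    rw [Fin.lt_def] at h2
    simp only at h3
    omega
  let v : Fin a.len ⊕ Fin b.len → Fin n := Sum.elim a.entry b.entry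
  -- There are `a.len - r` such positions in `a` and `r + 1` in `b`, just one more than the height
  -- of the larger minor.
  let P : Fin a.len ⊕ Fin b.len → Prop :=
    Sum.elim (fun c => (r : ℕ) ≤ c) (fun c => (c : ℕ) ≤ r)
  have hcard : a.len < Fintype.card {i // P i} := by
    rw [Fintype.card_congr Equiv.subtypeSum, Fintype.card_sum, Fintype.card_subtype,
      Fintype.card_subtype]
    have h1 : (Finset.univ.filter fun c : Fin a.len => P (Sum.inl c)).card = a.len - r := by
      convert PBWColumn.card_filter_le_val a.len r
      rfl
    have h2 : (Finset.univ.filter fun c : Fin b.len => P (Sum.inr c)).card = r + 1 := by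
      have h3 := PBWColumn.card_filter_le_val b.len (r + 1)
      have h4 := Finset.card_filter_add_card_filter_not (s := (Finset.univ : Finset (Fin b.len)))
        (fun c => P (Sum.inr c))
      have h5 : (Finset.univ.filter fun c : Fin b.len => ¬ P (Sum.inr c)) =
          Finset.univ.filter fun c : Fin b.len => (r : ℕ) + 1 ≤ c := by
        ext c
        simp only [Finset.mem_filter, Finset.mem_univ, true_and]
        exact Nat.not_le
      rw [h5, h3, Finset.card_univ, Fintype.card_fin] at h4
      have := r.2
      omega
    rw [h1, h2]
    have := r.2
    omega
  have hrel := garnir_relation z hlen a.len_lt.le v P hcard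
  set t : Equiv.Perm {i // P i} → A := fun σ => Equiv.Perm.sign σ •
      ((z.submatrix (Fin.castLE a.len_lt.le) fun c => v (ofSubtype σ (Sum.inl c))).det *
        (z.submatrix (Fin.castLE (hlen.trans a.len_lt.le))
          fun c => v (ofSubtype σ (Sum.inr c))).det) with ht
  let C : Equiv.Perm {i // P i} → Prop := fun σ =>
    Set.MapsTo (ofSubtype σ) (Set.range Sum.inr) (Set.range Sum.inr)
  -- If `σ` permutes each column within itself, the signs from the two determinants cancel `sign σ`,
  -- so all these terms agree instead of cancelling.
  have htrivial : ∀ σ, C σ → t σ = plueckerCoord z a * plueckerCoord z b := by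
    intro σ hσ
    obtain ⟨⟨σ₁, σ₂⟩, h⟩ := mem_sumCongrHom_range_of_perm_mapsTo_inl
      ((perm_mapsTo_inl_iff_mapsTo_inr _).2 hσ)
    have hσ' : ofSubtype σ = Equiv.Perm.sumCongr σ₁ σ₂ := h.symm
    have hsign : sign σ = sign σ₁ * sign σ₂ := by
      rw [← sign_ofSubtype, hσ', sign_sumCongr]
    have h1 : (z.submatrix (Fin.castLE a.len_lt.le) fun c => v (ofSubtype σ (Sum.inl c))) =
        (z.submatrix (Fin.castLE a.len_lt.le) a.entry).submatrix id σ₁ := by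
      ext i j
      simp [hσ', v]
    have h2 : (z.submatrix (Fin.castLE (hlen.trans a.len_lt.le))
        fun c => v (ofSubtype σ (Sum.inr c))) =
        (z.submatrix (Fin.castLE b.len_lt.le) b.entry).submatrix id σ₂ := by
      ext i j
      simp [hσ', v]
    simp only [ht]
    rw [h1, h2, Matrix.det_permute', Matrix.det_permute', hsign, Units.smul_def, zsmul_eq_mul]
    push_cast
    have e1 : (((sign σ₁ : ℤˣ) : ℤ) : A) * (((sign σ₁ : ℤˣ) : ℤ) : A) = 1 := by
      rw [← Int.cast_mul, Int.units_coe_mul_self, Int.cast_one]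
    have e2 : (((sign σ₂ : ℤˣ) : ℤ) : A) * (((sign σ₂ : ℤˣ) : ℤ) : A) = 1 := by
      rw [← Int.cast_mul, Int.units_coe_mul_self, Int.cast_one]
    change _ * _ * (_ * plueckerCoord z a * (_ * plueckerCoord z b)) = _
    linear_combination (plueckerCoord z a * plueckerCoord z b) *
      ((((sign σ₂ : ℤˣ) : ℤ) : A) * (((sign σ₂ : ℤˣ) : ℤ) : A) * e1 + e2)
  have hother : ∀ σ, ¬ C σ → t σ ∈ W := by
    intro σ hσ
    obtain ⟨c₀, d₀, hcd⟩ : ∃ c₀ d₀, ofSubtype σ (Sum.inr c₀) = Sum.inl d₀ := by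
      by_contra hno
      push Not at hno
      refine hσ ?_
      rintro _ ⟨c, rfl⟩
      rcases h : ofSubtype σ (Sum.inr c) with d | d
      · exact (hno c d h).elim
      · exact ⟨d, rfl⟩
    set α : Fin a.len → Fin n := fun c => v (ofSubtype σ (Sum.inl c)) with hα
    set β : Fin b.len → Fin n := fun c => v (ofSubtype σ (Sum.inr c)) with hβ
    by_cases hαi : Function.Injective α
    swap
    · simp only [ht]
      rw [minor_eq_zero z _ hαi, zero_mul, smul_zero]
      exact W.zero_mem
    by_cases hβi : Function.Injective β
    swap
    · simp only [ht]
      rw [minor_eq_zero z (hlen.trans a.len_lt.le) hβi, mul_zero, smul_zero]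
      exact W.zero_mem
    obtain ⟨a', ε, ha1, ha2, ha3⟩ := exists_plueckerCoord_of_injective z a.len_pos a.len_lt hαi
    obtain ⟨b', δ, hb1, hb2, hb3⟩ := exists_plueckerCoord_of_injective z b.len_pos b.len_lt hβi
    have hmem : plueckerCoord z a' * plueckerCoord z b' ∈ W := by
      refine Submodule.subset_span ⟨a', b', ha1, hb1, ?_, ?_, rfl⟩
      · have hsum : ∀ f : Fin a.len ⊕ Fin b.len → Fin n,
            (Finset.univ.val.map fun c => f (Sum.inl c)) +
              (Finset.univ.val.map fun c => f (Sum.inr c)) = Finset.univ.val.map f := by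
          intro f
          change _ = Multiset.map f (Multiset.disjSum _ _)
          rw [Multiset.disjSum, Multiset.map_add, Multiset.map_map, Multiset.map_map]
          rfl
        rw [ha2, hb2, Finset.image_val_of_injOn hαi.injOn, Finset.image_val_of_injOn hβi.injOn,
          PBWColumn.entries, PBWColumn.entries, Finset.image_val_of_injOn a.entry_injective.injOn,
          Finset.image_val_of_injOn b.entry_injective.injOn]
        refine (hsum fun i => v (ofSubtype σ i)).trans (Eq.trans ?_ (hsum v).symm)
        rw [← Function.comp_def, ← Multiset.map_map v (ofSubtype σ), Multiset.map_univ_val_equiv]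
      -- Some letter of `a` from position `r` or below enters the top part of `b`; it is at least
      -- `r` by `le_entry` and less than `b.entry r` by the choice of `r`.
      · refine b.profWeight_lt_of_exchange b' r hM hβi hb1 hb2 (fun c hc => ?_) ⟨c₀, ?_⟩
        · have : ¬ P (Sum.inr c) := by
            simpa [P] using hc
          simp only [hβ, ofSubtype_apply_of_not_mem σ this]
          rfl
        · have hP : P (Sum.inr c₀) := by
            by_contra hP
            rw [ofSubtype_apply_of_not_mem σ hP] at hcd
            cases hcd
          have hP' : P (Sum.inl d₀) := by
            rw [← hcd, ofSubtype_apply_of_mem σ hP]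
            exact (σ ⟨_, hP⟩).2
          have hd : (r : ℕ) ≤ d₀ := hP'
          have hval : β c₀ = a.entry d₀ := by
            simp only [hβ, hcd]
            rfl
          rw [hval]
          exact ⟨hP, hd.trans (a.le_entry d₀), hr d₀ hd⟩
    have : t σ = (sign σ * ε * δ) • (plueckerCoord z a' * plueckerCoord z b') := by
      simp only [ht]
      rw [ha3, hb3, smul_mul_smul_comm, smul_smul, mul_assoc]
    rw [this, Units.smul_def]
    exact zsmul_mem hmem _
  have hC1 : C 1 := by
    simp only [C, map_one]
    exact fun x hx => hx
  rw [← Finset.sum_filter_add_sum_filter_not _ C,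
    Finset.sum_congr rfl fun σ hσ => htrivial σ (Finset.mem_filter.1 hσ).2, Finset.sum_const,
    add_eq_zero_iff_eq_neg] at hrel
  -- The trivial terms add up to `N` copies of the product, and `N` is invertible in characteristic
  -- zero.
  set N := (Finset.univ.filter C).card with hN
  have hN0 : N ≠ 0 := Finset.card_ne_zero_of_mem (Finset.mem_filter.2 ⟨Finset.mem_univ 1, hC1⟩)
  have hmem : (N : ℂ) • (plueckerCoord z a * plueckerCoord z b) ∈ W := by
    rw [Nat.cast_smul_eq_nsmul, hrel]
    exact W.neg_mem (W.sum_mem fun σ hσ => hother σ (Finset.mem_filter.1 hσ).2)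
  have := W.smul_mem (N : ℂ)⁻¹ hmem
  rwa [smul_smul, inv_mul_cancel₀ (Nat.cast_ne_zero.2 hN0), one_smul] at this

/-- Products of two Plücker coordinates are combinations of standard ones of the same weight. -/
theorem plueckerCoord_mul_mem_span_standard (z : Matrix (Fin n) (Fin n) A) (a b : PBWColumn n) :
    plueckerCoord z a * plueckerCoord z b ∈ Submodule.span ℂ
      {x | ∃ g h : PBWColumn n, g ≤ h ∧
        g.entries.val + h.entries.val = a.entries.val + b.entries.val ∧
        x = plueckerCoord z g * plueckerCoord z h} := by
  suffices H : ∀ N, ∀ a b : PBWColumn n, b.profWeight < N → b.len ≤ a.len →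
      plueckerCoord z a * plueckerCoord z b ∈ Submodule.span ℂ
        {x | ∃ g h : PBWColumn n, g ≤ h ∧
          g.entries.val + h.entries.val = a.entries.val + b.entries.val ∧
          x = plueckerCoord z g * plueckerCoord z h} by
    rcases le_total b.len a.len with h | h
    · exact H _ a b (Nat.lt_succ_self _) h
    · rw [mul_comm, add_comm a.entries.val]
      exact H _ b a (Nat.lt_succ_self _) h
  intro N
  induction N with
  | zero => exact fun a b h => (Nat.not_lt_zero _ h).elim
  | succ N ih =>
    intro a b hN hlen
    by_cases hab : b ≤ a
    · exact Submodule.subset_span ⟨b, a, hab, add_comm _ _, mul_comm _ _⟩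
    · refine Submodule.span_le.2 ?_ (plueckerCoord_mul_mem_span_exchange z a b hlen hab)
      rintro _ ⟨a', b', ha, hb, hcont, hlt, rfl⟩
      have := ih a' b' (by omega) (by omega)
      rwa [hcont] at this

end QuadraticSpanning

/-! ### Polynomials whose leading monomial divides every term -/

open MvPolynomial in
/-- `f` is the monomial with exponent `e` times a polynomial with constant term `1`. -/
def HasLead {σ : Type*} (f : MvPolynomial σ ℂ) (e : σ →₀ ℕ) : Prop :=
  ∃ u : MvPolynomial σ ℂ, constantCoeff u = 1 ∧ f = monomial e 1 * u

namespace HasLead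

open MvPolynomial

variable {σ ι : Type*} {f g : MvPolynomial σ ℂ} {d e : σ →₀ ℕ}

theorem one : HasLead (1 : MvPolynomial σ ℂ) 0 := ⟨1, map_one _, by simp⟩

theorem mul (hf : HasLead f d) (hg : HasLead g e) : HasLead (f * g) (d + e) := by
  obtain ⟨u, hu, rfl⟩ := hf
  obtain ⟨v, hv, rfl⟩ := hg
  refine ⟨u * v, by rw [map_mul, hu, hv, one_mul], ?_⟩
  rw [show (monomial (d + e) (1 : ℂ)) = monomial d 1 * monomial e 1 by
    rw [monomial_mul, one_mul]]
  ring

theorem pow (hf : HasLead f d) (k : ℕ) : HasLead (f ^ k) (k • d) := by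
  induction k with
  | zero => simpa using one
  | succ k ih => rw [pow_succ, succ_nsmul]; exact ih.mul hf

theorem prod {s : Finset ι} {F : ι → MvPolynomial σ ℂ} {E : ι → σ →₀ ℕ}
    (h : ∀ i ∈ s, HasLead (F i) (E i)) : HasLead (∏ i ∈ s, F i) (∑ i ∈ s, E i) := by
  classical
  induction s using Finset.induction_on with
  | empty => simpa using one
  | insert i s hi ih =>
    rw [Finset.prod_insert hi, Finset.sum_insert hi]
    exact (h i (Finset.mem_insert_self i s)).mul (ih fun j hj => h j (Finset.mem_insert_of_mem hj))

theorem coeff_self (hf : HasLead f e) : coeff e f = 1 := by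
  classical
  obtain ⟨u, hu, rfl⟩ := hf
  rw [coeff_monomial_mul', if_pos le_rfl, tsub_self, one_mul]
  exact hu

theorem le_of_coeff_ne_zero (hf : HasLead f e) (h : coeff d f ≠ 0) : e ≤ d := by
  classical
  obtain ⟨u, hu, rfl⟩ := hf
  rw [coeff_monomial_mul'] at h
  by_contra hc
  exact h (if_neg hc)

/-- Below every exponent occurring among the summands of a combination of polynomials with
distinct leading exponents there is one that survives in the sum. -/
theorem exists_coeff_ne_zero {F : ι → MvPolynomial σ ℂ} {E : ι → σ →₀ ℕ}
    (hF : ∀ i, HasLead (F i) (E i)) {c : ι →₀ ℂ} (hE : Set.InjOn E c.support) {i : ι}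
    (hi : i ∈ c.support) :
    ∃ j ∈ c.support, E j ≤ E i ∧ coeff (E j) (c.sum fun i x => x • F i) ≠ 0 := by
  -- A minimal exponent below `E i` cannot be cancelled: another summand reaches it only if its own
  -- leading exponent lies below, hence equals it.
  obtain ⟨j, hji, hj, hmin⟩ : ∃ j, E j ≤ E i ∧ j ∈ c.support ∧
      ∀ k ∈ c.support, E k ≤ E j → k = j := by
    obtain ⟨e, hei, he⟩ := ((c.support.finite_toSet).image E).exists_le_minimal
      (Set.mem_image_of_mem E hi)
    obtain ⟨j, hj, rfl⟩ := he.1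
    exact ⟨j, hei, hj, fun k hk hkj =>
      hE hk hj (le_antisymm hkj (he.2 (Set.mem_image_of_mem E hk) hkj))⟩
  refine ⟨j, hj, hji, ?_⟩
  rw [Finsupp.sum, coeff_sum, Finset.sum_eq_single j]
  · rw [coeff_smul, (hF j).coeff_self, smul_eq_mul, mul_one]
    exact Finsupp.mem_support_iff.1 hj
  · intro k hk hkj
    rw [coeff_smul, smul_eq_zero]
    right
    by_contra h
    exact hkj (hmin k hk ((hF k).le_of_coeff_ne_zero h))
  · exact fun h => (h hj).elim

theorem linearIndependent {F : ι → MvPolynomial σ ℂ} {E : ι → σ →₀ ℕ}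
    (hF : ∀ i, HasLead (F i) (E i)) (hE : Function.Injective E) : LinearIndependent ℂ F := by
  rw [linearIndependent_iff]
  intro c hc
  by_contra h
  obtain ⟨i, hi⟩ := Finsupp.support_nonempty_iff.2 h
  obtain ⟨j, -, -, hj⟩ := exists_coeff_ne_zero hF hE.injOn hi
  rw [Finsupp.linearCombination_apply] at hc
  rw [hc, coeff_zero] at hj
  exact hj rfl

end HasLead

/-! ### Leading exponents of Plücker coordinates -/

namespace PBWColumn

variable {n : ℕ}

/-- Exponents of the monomial substituted for an entry of an upper triangular matrix. -/
noncomputable def triExp (i j : Fin n) : Fin n × Fin n →₀ ℕ :=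
  Finsupp.equivFunOnFinite.symm fun p => if p.1 ≤ i ∧ p.2 ≤ j then 1 else 0

open MvPolynomial in
/-- An upper triangular matrix of monomials on which every Plücker coordinate has a leading term. -/
noncomputable def triMatrix (n : ℕ) : Matrix (Fin n) (Fin n) (MvPolynomial (Fin n × Fin n) ℂ) :=
  Matrix.of fun i j => if i ≤ j then monomial (triExp i j) 1 else 0

/-- The leading exponent of a Plücker coordinate on `triMatrix`. -/
noncomputable def leadExp (a : PBWColumn n) : Fin n × Fin n →₀ ℕ :=
  ∑ c, triExp (Fin.castLE a.len_lt.le c) (a.entry c)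

theorem sum_triExp_apply {k : ℕ} (f g : Fin k → Fin n) (p : Fin n × Fin n) :
    (∑ c, triExp (f c) (g c)) p = (Finset.univ.filter fun c => p.1 ≤ f c ∧ p.2 ≤ g c).card := by
  rw [Finsupp.finsetSum_apply, Finset.card_filter]
  rfl

theorem leadExp_apply (a : PBWColumn n) (s m : Fin n) : a.leadExp (s, m) =
    (Finset.univ.filter fun c : Fin a.len => (s : ℕ) ≤ c ∧ (m : ℕ) ≤ a.entry c).card := by
  rw [leadExp, sum_triExp_apply]
  rfl

/-- This links algebra to order: the support of the exponent is the region under the profile, so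
comparing columns is comparing supports. -/
theorem leadExp_pos_iff (a : PBWColumn n) (s m : Fin n) :
    0 < a.leadExp (s, m) ↔ (m : ℕ) < a.prof s := by
  rw [leadExp_apply, Finset.card_pos, lt_prof_iff_exists_le]
  simp [Finset.Nonempty]

/-- The condition on `σ` singles out the nonzero terms of the determinant. When the left side is
nonempty, a letter below `m` sent to a position at least `s` was already at such a position. So `σ`
cannot bring in small letters there, and the number of large ones cannot drop. -/
theorem card_filter_perm_le (a : PBWColumn n) (σ : Equiv.Perm (Fin a.len))
    (hσ : ∀ c, (σ c : ℕ) ≤ a.entry c) (s m : ℕ) :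
    (Finset.univ.filter fun c : Fin a.len => s ≤ (c : ℕ) ∧ m ≤ (a.entry c : ℕ)).card ≤
      (Finset.univ.filter fun c : Fin a.len => s ≤ (σ c : ℕ) ∧ m ≤ (a.entry c : ℕ)).card := by
  rcases Finset.eq_empty_or_nonempty
    (Finset.univ.filter fun c : Fin a.len => s ≤ (c : ℕ) ∧ m ≤ (a.entry c : ℕ)) with h | ⟨c₀, hc₀⟩
  · rw [h, Finset.card_empty]
    exact Nat.zero_le _
  have hm : m < a.prof s := a.lt_prof_iff_exists_le.2 ⟨c₀, by simpa using hc₀⟩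
  have h1 := Finset.card_filter_add_card_filter_not
    (s := Finset.univ.filter fun c : Fin a.len => s ≤ (c : ℕ)) fun c => m ≤ (a.entry c : ℕ)
  have h2 := Finset.card_filter_add_card_filter_not
    (s := Finset.univ.filter fun c : Fin a.len => s ≤ (σ c : ℕ)) fun c => m ≤ (a.entry c : ℕ)
  have h3 : (Finset.univ.filter fun c : Fin a.len => s ≤ (σ c : ℕ)).card =
      (Finset.univ.filter fun c : Fin a.len => s ≤ (c : ℕ)).card := by
    refine Finset.card_bij (fun c _ => σ c) (by simp) (fun c _ d _ h => σ.injective h) ?_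
    intro c hc
    exact ⟨σ.symm c, by simpa using hc, by simp⟩
  simp only [Finset.filter_filter] at h1 h2
  have h4 : (Finset.univ.filter fun c : Fin a.len => s ≤ (σ c : ℕ) ∧ ¬ m ≤ (a.entry c : ℕ)).card ≤
      (Finset.univ.filter fun c : Fin a.len => s ≤ (c : ℕ) ∧ ¬ m ≤ (a.entry c : ℕ)).card := by
    refine Finset.card_le_card fun c hc => ?_
    simp only [Finset.mem_filter, Finset.mem_univ, true_and, not_le] at hc ⊢
    exact ⟨a.le_pos_of_lt_prof hm c (hc.1.trans (hσ c)) hc.2, hc.2⟩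
  omega

/-- Differencing in `m` isolates one letter, as letters are distinct; its counts over all `s`
determine its position. -/
theorem perm_eq_one_of_card_filter (a : PBWColumn n) (σ : Equiv.Perm (Fin a.len))
    (h : ∀ s m : ℕ,
      (Finset.univ.filter fun c : Fin a.len => s ≤ (σ c : ℕ) ∧ m ≤ (a.entry c : ℕ)).card =
      (Finset.univ.filter fun c : Fin a.len => s ≤ (c : ℕ) ∧ m ≤ (a.entry c : ℕ)).card) :
    σ = 1 := by
  have hsplit : ∀ (f : Fin a.len → Fin a.len) (s m : ℕ),
      (Finset.univ.filter fun c : Fin a.len => s ≤ (f c : ℕ) ∧ m ≤ (a.entry c : ℕ)).card =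
      (Finset.univ.filter fun c : Fin a.len => s ≤ (f c : ℕ) ∧ m + 1 ≤ (a.entry c : ℕ)).card +
      (Finset.univ.filter fun c : Fin a.len => s ≤ (f c : ℕ) ∧ m = (a.entry c : ℕ)).card := by
    intro f s m
    rw [← Finset.card_union_of_disjoint]
    · congr 1
      ext c
      simp only [Finset.mem_filter, Finset.mem_univ, true_and, Finset.mem_union]
      omega
    · refine Finset.disjoint_filter.2 fun c _ h1 h2 => ?_
      omega
  ext c
  have hval : ∀ s : ℕ, s ≤ (σ c : ℕ) ↔ s ≤ (c : ℕ) := by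
    intro s
    have h1 := hsplit σ s (a.entry c)
    have h2 := hsplit id s (a.entry c)
    simp only [id] at h2
    rw [h, h] at h1
    have h3 : ∀ f : Fin a.len → Fin a.len, (Finset.univ.filter fun d : Fin a.len =>
        s ≤ (f d : ℕ) ∧ (a.entry c : ℕ) = (a.entry d : ℕ)).card = if s ≤ (f c : ℕ) then 1 else 0 := by
      intro f
      split_ifs with hs
      · refine Finset.card_eq_one.2 ⟨c, ?_⟩
        ext d
        simp only [Finset.mem_filter, Finset.mem_univ, true_and, Finset.mem_singleton]
        exact ⟨fun hd => (a.entry_injective (Fin.ext hd.2)).symm, by rintro rfl; exact ⟨hs, rfl⟩⟩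
      · refine Finset.card_eq_zero.2 (Finset.filter_eq_empty_iff.2 fun d _ hd => hs ?_)
        rw [a.entry_injective (Fin.ext hd.2)]
        exact hd.1
    have h4 := h3 σ
    have h5 := h3 id
    simp only [id] at h5
    rw [h4] at h1
    rw [h5] at h2
    split_ifs at h1 h2 <;> omega
  exact le_antisymm ((hval _).1 le_rfl) ((hval _).2 le_rfl)

-- In the Leibniz expansion every surviving exponent dominates the diagonal one, with equality only
-- for the identity. Dividing by the diagonal monomial therefore leaves constant term 1.
open MvPolynomial in
theorem hasLead_plueckerCoord (a : PBWColumn n) :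
    HasLead (plueckerCoord (triMatrix n) a) a.leadExp := by
  classical
  set E : Equiv.Perm (Fin a.len) → Fin n × Fin n →₀ ℕ := fun σ =>
    ∑ c, triExp (Fin.castLE a.len_lt.le (σ c)) (a.entry c) with hE
  have hE1 : E 1 = a.leadExp := rfl
  have hle : ∀ σ : Equiv.Perm (Fin a.len), (∀ c, (σ c : ℕ) ≤ a.entry c) → a.leadExp ≤ E σ := by
    intro σ hσ p
    rw [hE, leadExp, sum_triExp_apply, sum_triExp_apply]
    exact a.card_filter_perm_le σ hσ p.1 p.2
  have heq : ∀ σ : Equiv.Perm (Fin a.len), E σ = a.leadExp → σ = 1 := by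
    intro σ hσ
    refine a.perm_eq_one_of_card_filter σ fun s m => ?_
    by_cases hs : s < n
    · by_cases hm : m < n
      · have := DFunLike.congr_fun hσ (⟨s, hs⟩, ⟨m, hm⟩)
        rwa [hE, leadExp, sum_triExp_apply, sum_triExp_apply] at this
      · rw [Finset.filter_false_of_mem, Finset.filter_false_of_mem]
        all_goals intro c _; have := (a.entry c).2; omega
    · have := a.len_lt
      rw [Finset.filter_false_of_mem, Finset.filter_false_of_mem]
      · intro c _
        omega
      · intro c _
        have := (σ c).2
        omega
  refine ⟨∑ σ : Equiv.Perm (Fin a.len), if ∀ c, (σ c : ℕ) ≤ a.entry c then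
    (((Equiv.Perm.sign σ : ℤˣ) : ℤ) : MvPolynomial (Fin n × Fin n) ℂ) *
      monomial (E σ - a.leadExp) 1 else 0, ?_, ?_⟩
  · rw [map_sum, Finset.sum_eq_single 1]
    · rw [if_pos (show ∀ c, ((1 : Equiv.Perm (Fin a.len)) c : ℕ) ≤ a.entry c from a.le_entry), hE1,
        tsub_self]
      simp
    · intro σ _ hσ
      split_ifs with h
      · rw [map_mul, constantCoeff_monomial, if_neg, mul_zero]
        intro h0
        exact hσ (heq σ (le_antisymm (tsub_eq_zero_iff_le.1 h0) (hle σ h)))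
      · exact map_zero _
    · exact fun h => (h (Finset.mem_univ _)).elim
  · rw [plueckerCoord, Matrix.det_apply', Finset.mul_sum]
    refine Finset.sum_congr rfl fun σ _ => ?_
    split_ifs with h
    · have h1 : ∏ c, (triMatrix n).submatrix (Fin.castLE a.len_lt.le) a.entry (σ c) c =
          monomial (E σ) 1 := by
        rw [hE, monomial_sum_one]
        refine Finset.prod_congr rfl fun c _ => ?_
        exact if_pos (Fin.le_def.2 (h c))
      rw [h1, mul_left_comm, monomial_mul, one_mul, add_tsub_cancel_of_le (hle σ h)]
    · push Not at h
      obtain ⟨c, hc⟩ := h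
      rw [mul_zero, Finset.prod_eq_zero (Finset.mem_univ c), mul_zero]
      exact if_neg (by rw [Fin.le_def]; simpa using hc)

end PBWColumn

open MvPolynomial in
/-- Plücker relations hold for every matrix over every algebra. -/
theorem aeval_plueckerCoord_eq_zero {A : Type*} [CommRing A] [Algebra ℂ A] {n : ℕ}
    (z : Matrix (Fin n) (Fin n) A) {p : PlueckerRing n} (hp : p ∈ plueckerIdeal n) :
    aeval (plueckerCoord z) p = 0 := by
  have h1 : aeval (plueckerCoord z) =
      (aeval (R := ℂ) fun ij : Fin n × Fin n => z ij.1 ij.2).comp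
        (aeval (R := ℂ) (plueckerCoord (Matrix.mvPolynomialX (Fin n) (Fin n) ℂ))) := by
    refine MvPolynomial.algHom_ext fun b => ?_
    rw [AlgHom.comp_apply, aeval_X, aeval_X, plueckerCoord, plueckerCoord, AlgHom.map_det]
    congr 1
    ext i j
    simp [Matrix.mvPolynomialX]
  have h2 : aeval (R := ℂ) (plueckerCoord (Matrix.mvPolynomialX (Fin n) (Fin n) ℂ)) p = 0 := hp
  rw [h1, AlgHom.comp_apply, h2, map_zero]

/-! ### Independence of standard monomials -/

namespace PBWColumn

variable {n : ℕ}

theorem le_iff_leadExp {a b : PBWColumn n} :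
    a ≤ b ↔ ∀ p, 0 < a.leadExp p → 0 < b.leadExp p := by
  rw [le_iff_lt_prof]
  constructor
  · rintro h ⟨s, m⟩ hp
    rw [leadExp_pos_iff] at hp ⊢
    exact h s m hp
  · intro h s m hm
    have hs : s < n := by
      by_contra hs
      have := a.len_lt
      rw [a.prof_eq_zero (by omega)] at hm
      exact Nat.not_lt_zero _ hm
    have := h (⟨s, hs⟩, ⟨m, hm.trans_le (a.prof_le s)⟩)
    rw [leadExp_pos_iff, leadExp_pos_iff] at this
    exact this hm

theorem leadExp_pos_of_le {a b : PBWColumn n} (h : a ≤ b) {p : Fin n × Fin n}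
    (hp : 0 < a.leadExp p) : 0 < b.leadExp p := le_iff_leadExp.1 h p hp

theorem eq_of_leadExp_pos_iff {a b : PBWColumn n}
    (h : ∀ p, 0 < a.leadExp p ↔ 0 < b.leadExp p) : a = b :=
  le_antisymm (le_iff_leadExp.2 fun p => (h p).1) (le_iff_leadExp.2 fun p => (h p).2)

theorem leadExp_injective : Function.Injective (leadExp (n := n)) :=
  fun a b h => eq_of_leadExp_pos_iff fun p => by rw [h]

theorem leadExp_ne_zero (a : PBWColumn n) : a.leadExp ≠ 0 := by
  intro h
  have h1 := a.len_pos
  have h2 := a.len_lt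
  have h3 := (a.leadExp_pos_iff ⟨0, by omega⟩ ⟨0, by omega⟩).2
    (lt_of_lt_of_le h1 (a.len_le_prof h1))
  rw [h] at h3
  exact lt_irrefl _ h3

theorem leadExp_add_pos_iff {g h : PBWColumn n} (hgh : g ≤ h) (p : Fin n × Fin n) :
    0 < (g.leadExp + h.leadExp) p ↔ 0 < h.leadExp p := by
  rw [Finsupp.add_apply]
  have := leadExp_pos_of_le hgh (p := p)
  omega

/-- For `g ≤ h` the sum has the same support as `h.leadExp`. This recovers `h`, and `g` follows by
cancellation. -/
theorem pair_eq_of_leadExp_add {g h g' h' : PBWColumn n} (hgh : g ≤ h) (hgh' : g' ≤ h')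
    (heq : g.leadExp + h.leadExp = g'.leadExp + h'.leadExp) : g = g' ∧ h = h' := by
  have h1 : h = h' := eq_of_leadExp_pos_iff fun p => by
    rw [← leadExp_add_pos_iff hgh, heq, leadExp_add_pos_iff hgh']
  subst h1
  exact ⟨leadExp_injective (add_right_cancel heq), rfl⟩

theorem sup_le_of_leadExp_le {a b g h : PBWColumn n} (hgh : g ≤ h)
    (hle : a.leadExp + b.leadExp ≤ g.leadExp + h.leadExp) : a ⊔ b ≤ h := by
  refine sup_le (le_iff_leadExp.2 fun p hp => ?_) (le_iff_leadExp.2 fun p hp => ?_)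
  all_goals
    rw [← leadExp_add_pos_iff hgh]
    refine lt_of_lt_of_le ?_ (hle p)
    rw [Finsupp.add_apply]
    omega

/-- The leading exponent of a monomial in the Plücker coordinates. -/
noncomputable def monomialLeadExp (d : PBWColumn n →₀ ℕ) : Fin n × Fin n →₀ ℕ :=
  d.sum fun a k => k • a.leadExp

theorem hasLead_monomial (d : PBWColumn n →₀ ℕ) :
    HasLead (d.prod fun a k => plueckerCoord (triMatrix n) a ^ k) (monomialLeadExp d) :=
  HasLead.prod fun a _ => (hasLead_plueckerCoord a).pow (d a)

theorem monomialLeadExp_add (d e : PBWColumn n →₀ ℕ) :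
    monomialLeadExp (d + e) = monomialLeadExp d + monomialLeadExp e :=
  Finsupp.sum_add_index' (by simp) fun _ _ _ => add_smul _ _ _

theorem monomialLeadExp_single (a : PBWColumn n) :
    monomialLeadExp (Finsupp.single a 1) = a.leadExp := by
  simp [monomialLeadExp]

theorem leadExp_le_monomialLeadExp {d : PBWColumn n →₀ ℕ} {a : PBWColumn n} (ha : a ∈ d.support) :
    a.leadExp ≤ monomialLeadExp d := by
  have h : d = (d - Finsupp.single a 1) + Finsupp.single a 1 :=
    (tsub_add_cancel_of_le (Finsupp.single_le_iff.2
      (Nat.one_le_iff_ne_zero.2 (Finsupp.mem_support_iff.1 ha)))).symm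
  rw [h, monomialLeadExp_add, monomialLeadExp_single]
  exact le_add_self

/-- A nonzero standard monomial has a largest factor. -/
theorem _root_.IsStandardMonomial.exists_greatest {Ω : Type*} [PartialOrder Ω] {d : Ω →₀ ℕ}
    (hd : IsStandardMonomial d) (h0 : d ≠ 0) : ∃ a ∈ d.support, ∀ b ∈ d.support, b ≤ a := by
  obtain ⟨a, ha⟩ := d.support.exists_maximal (Finsupp.support_nonempty_iff.2 h0)
  exact ⟨a, ha.1, fun b hb => (hd a ha.1 b hb).elim (fun h => ha.2 hb h) id⟩

theorem _root_.IsStandardMonomial.of_le {Ω : Type*} [PartialOrder Ω] {d e : Ω →₀ ℕ}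
    (hd : IsStandardMonomial d) (h : e ≤ d) : IsStandardMonomial e := fun a ha b hb =>
  hd a (Finsupp.support_mono h ha) b (Finsupp.support_mono h hb)

theorem monomialLeadExp_pos_iff {d : PBWColumn n →₀ ℕ} {a : PBWColumn n} (ha : a ∈ d.support)
    (hmax : ∀ b ∈ d.support, b ≤ a) (p : Fin n × Fin n) :
    0 < monomialLeadExp d p ↔ 0 < a.leadExp p := by
  refine ⟨fun h => ?_, fun h => h.trans_le (leadExp_le_monomialLeadExp ha p)⟩
  rw [monomialLeadExp, Finsupp.sum, Finsupp.finsetSum_apply] at h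
  obtain ⟨b, hb, hb'⟩ := Finset.exists_ne_zero_of_sum_ne_zero h.ne'
  refine leadExp_pos_of_le (hmax b hb) (Nat.pos_of_ne_zero fun h0 => hb' ?_)
  rw [Finsupp.smul_apply, h0, smul_zero]

theorem monomialLeadExp_eq_zero {d : PBWColumn n →₀ ℕ} (h : monomialLeadExp d = 0) : d = 0 := by
  by_contra h0
  obtain ⟨a, ha⟩ := Finsupp.support_nonempty_iff.2 h0
  have := leadExp_le_monomialLeadExp ha
  rw [h] at this
  exact a.leadExp_ne_zero (le_antisymm this bot_le)

/-- The support of the exponent is that of the greatest factor, which is thus common to both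
monomials; remove it and induct on the degree. -/
theorem monomialLeadExp_injective {d e : PBWColumn n →₀ ℕ} (hd : IsStandardMonomial d)
    (he : IsStandardMonomial e) (h : monomialLeadExp d = monomialLeadExp e) : d = e := by
  induction hN : d.degree generalizing d e with
  | zero =>
    have h0 : d = 0 := (Finsupp.degree_eq_zero_iff d).1 hN
    subst h0
    exact (monomialLeadExp_eq_zero (h ▸ by simp [monomialLeadExp])).symm
  | succ N ih =>
    have hd0 : d ≠ 0 := by
      rintro rfl
      simp at hN
    have he0 : e ≠ 0 := by
      rintro rfl
      exact hd0 (monomialLeadExp_eq_zero (h.trans (by simp [monomialLeadExp])))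
    obtain ⟨a, ha, hamax⟩ := hd.exists_greatest hd0
    obtain ⟨b, hb, hbmax⟩ := he.exists_greatest he0
    obtain rfl : a = b := eq_of_leadExp_pos_iff fun p => by
      rw [← monomialLeadExp_pos_iff ha hamax, h, monomialLeadExp_pos_iff hb hbmax]
    have hs : ∀ f : PBWColumn n →₀ ℕ, a ∈ f.support →
        f = (f - Finsupp.single a 1) + Finsupp.single a 1 := fun f hf =>
      (tsub_add_cancel_of_le (Finsupp.single_le_iff.2
        (Nat.one_le_iff_ne_zero.2 (Finsupp.mem_support_iff.1 hf)))).symm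
    have hd' := hs d ha
    have he' := hs e hb
    rw [hd', he', monomialLeadExp_add, monomialLeadExp_add] at h
    have hdeg : (d - Finsupp.single a 1).degree = N := by
      rw [hd', map_add, Finsupp.degree_single] at hN
      omega
    rw [hd', he', ih (hd.of_le tsub_le_self) (he.of_le tsub_le_self) (add_right_cancel h) hdeg]

open MvPolynomial

/-- The standard monomials are linearly independent modulo the Plücker ideal. -/
theorem linearIndependent_standard (n : ℕ) : LinearIndependent ℂ
    fun d : {d : PBWColumn n →₀ ℕ // IsStandardMonomial d} =>
      d.1.prod fun ω k => Ideal.Quotient.mk (plueckerIdeal n) (X ω) ^ k := by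
  let φ : PlueckerRing n ⧸ plueckerIdeal n →ₐ[ℂ] MvPolynomial (Fin n × Fin n) ℂ :=
    Ideal.Quotient.liftₐ (plueckerIdeal n) (aeval (plueckerCoord (triMatrix n)))
      fun p hp => aeval_plueckerCoord_eq_zero _ hp
  refine LinearIndependent.of_comp φ.toLinearMap ?_
  have : φ.toLinearMap ∘ (fun d : {d : PBWColumn n →₀ ℕ // IsStandardMonomial d} =>
      d.1.prod fun ω k => Ideal.Quotient.mk (plueckerIdeal n) (X ω) ^ k) =
      fun d => d.1.prod fun a k => plueckerCoord (triMatrix n) a ^ k := by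
    funext d
    simp only [Function.comp_apply, AlgHom.toLinearMap_apply, Finsupp.prod, map_prod, map_pow]
    refine Finset.prod_congr rfl fun a _ => ?_
    congr 1
    exact aeval_X _ _
  rw [this]
  exact HasLead.linearIndependent (fun d => hasLead_monomial d.1)
    fun d e h => Subtype.ext (monomialLeadExp_injective d.2 e.2 h)

/-- The quadratic form with coefficients `c`. -/
noncomputable def quadForm (c : PBWColumn n × PBWColumn n →₀ ℂ) : PlueckerRing n :=
  c.sum fun p x => C x * (X p.1 * X p.2)

/-! ### Leading exponents in a quadratic relation -/

section Leading

variable {a b : PBWColumn n} {κ : ℂ} {c : PBWColumn n × PBWColumn n →₀ ℂ}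

theorem sum_eq_of_mem (hrel : C κ * (X a * X b) - quadForm c ∈ plueckerIdeal n) :
    (c.sum fun p x => x • (plueckerCoord (triMatrix n) p.1 * plueckerCoord (triMatrix n) p.2)) =
      κ • (plueckerCoord (triMatrix n) a * plueckerCoord (triMatrix n) b) := by
  have h := aeval_plueckerCoord_eq_zero (triMatrix n) hrel
  rw [map_sub, sub_eq_zero] at h
  simp only [quadForm, map_mul, aeval_X, aeval_C, Finsupp.sum, map_sum] at h
  simp only [Algebra.smul_def, Finsupp.sum]
  exact h.symm

theorem leadExp_injOn (hc : ∀ p ∈ c.support, p.1 ≤ p.2) :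
    Set.InjOn (fun p : PBWColumn n × PBWColumn n => p.1.leadExp + p.2.leadExp) c.support := by
  intro p hp q hq h
  have := pair_eq_of_leadExp_add (hc p hp) (hc q hq) h
  exact Prod.ext this.1 this.2

/-- Below the exponent of each term lies one that survives in the whole sum, hence occurs in the
product for `a` and `b`, all of whose exponents dominate the leading one. The scalar `κ` allows the
constants produced by duality. -/
theorem leadExp_le_of_mem_support (hc : ∀ p ∈ c.support, p.1 ≤ p.2)
    (hrel : C κ * (X a * X b) - quadForm c ∈ plueckerIdeal n) {p : PBWColumn n × PBWColumn n}
    (hp : p ∈ c.support) : a.leadExp + b.leadExp ≤ p.1.leadExp + p.2.leadExp := by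
  obtain ⟨q, -, hqp, hq⟩ := HasLead.exists_coeff_ne_zero
    (fun p : PBWColumn n × PBWColumn n =>
      (hasLead_plueckerCoord p.1).mul (hasLead_plueckerCoord p.2)) (leadExp_injOn hc) hp
  rw [sum_eq_of_mem hrel, coeff_smul, smul_ne_zero_iff] at hq
  exact (((hasLead_plueckerCoord a).mul (hasLead_plueckerCoord b)).le_of_coeff_ne_zero hq.2).trans
    hqp

theorem exists_leadExp_eq (hκ : κ ≠ 0) (hc : ∀ p ∈ c.support, p.1 ≤ p.2)
    (hrel : C κ * (X a * X b) - quadForm c ∈ plueckerIdeal n) :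
    ∃ p ∈ c.support, p.1.leadExp + p.2.leadExp = a.leadExp + b.leadExp ∧ c p = κ := by
  have h := congrArg (coeff (a.leadExp + b.leadExp)) (sum_eq_of_mem hrel)
  have hlead := fun p : PBWColumn n × PBWColumn n =>
      (hasLead_plueckerCoord p.1).mul (hasLead_plueckerCoord p.2)
  rw [coeff_smul, (hlead (a, b)).coeff_self, smul_eq_mul, mul_one, Finsupp.sum, coeff_sum] at h
  have heq : ∀ p ∈ c.support, coeff (a.leadExp + b.leadExp)
      (c p • (plueckerCoord (triMatrix n) p.1 * plueckerCoord (triMatrix n) p.2)) ≠ 0 →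
      p.1.leadExp + p.2.leadExp = a.leadExp + b.leadExp := by
    intro p hp hne
    rw [coeff_smul, smul_ne_zero_iff] at hne
    exact le_antisymm ((hlead p).le_of_coeff_ne_zero hne.2) (leadExp_le_of_mem_support hc hrel hp)
  obtain ⟨p, hp, hne⟩ := Finset.exists_ne_zero_of_sum_ne_zero (h.trans_ne hκ)
  refine ⟨p, hp, heq p hp hne, ?_⟩
  rw [Finset.sum_eq_single p, coeff_smul, ← heq p hp hne, (hlead p).coeff_self, smul_eq_mul,
    mul_one] at h
  · exact h
  · intro q hq hqp
    by_contra hne'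
    exact hqp (leadExp_injOn hc hq hp ((heq q hq hne').trans (heq p hp hne).symm))
  · exact fun h' => (h' hp).elim

end Leading

end PBWColumn

/-! ### Duality through complementary minors -/

/-- Jacobi's theorem on complementary minors. -/
theorem Matrix.det_toBlocks₁₁_eq_of_mul_eq_one {m l R : Type*} [Fintype m] [DecidableEq m]
    [Fintype l] [DecidableEq l] [CommRing R] {G H : Matrix (m ⊕ l) (m ⊕ l) R} (h : G * H = 1) :
    G.toBlocks₁₁.det = G.det * H.toBlocks₂₂.det := by
  have h1 : Matrix.fromBlocks G.toBlocks₁₁ G.toBlocks₁₂ G.toBlocks₂₁ G.toBlocks₂₂ *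
      Matrix.fromBlocks H.toBlocks₁₁ H.toBlocks₁₂ H.toBlocks₂₁ H.toBlocks₂₂ =
      Matrix.fromBlocks 1 0 0 1 := by
    rw [Matrix.fromBlocks_toBlocks, Matrix.fromBlocks_toBlocks, h, Matrix.fromBlocks_one]
  rw [Matrix.fromBlocks_multiply, Matrix.fromBlocks_inj] at h1
  -- Replacing the first block column of `H` by that of the identity makes both the second factor
  -- and the product block triangular.
  have h2 : G * Matrix.fromBlocks 1 H.toBlocks₁₂ 0 H.toBlocks₂₂ =
      Matrix.fromBlocks G.toBlocks₁₁ 0 G.toBlocks₂₁ 1 := by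
    conv_lhs => rw [← Matrix.fromBlocks_toBlocks G]
    rw [Matrix.fromBlocks_multiply, h1.2.1, h1.2.2.2]
    simp
  have h3 := congrArg Matrix.det h2
  rw [Matrix.det_mul, Matrix.det_fromBlocks_zero₂₁, Matrix.det_fromBlocks_zero₁₂, Matrix.det_one,
    Matrix.det_one, one_mul, mul_one] at h3
  exact h3.symm

namespace PBWColumn

variable {n : ℕ}

/-- The relabelling of letters in the duality of columns. -/
def dualLetter (x : Fin n) : Fin n := if h : (x : ℕ) + 1 < n then ⟨n - 2 - x, by omega⟩ else x

theorem val_dualLetter (x : Fin n) :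
    (dualLetter x : ℕ) = if (x : ℕ) + 1 < n then n - 2 - x else x := by
  unfold dualLetter
  split_ifs <;> rfl

theorem dualLetter_injective : Function.Injective (dualLetter (n := n)) := by
  intro x y h
  have hx := x.2
  have hy := y.2
  rw [Fin.ext_iff, val_dualLetter, val_dualLetter] at h
  rw [Fin.ext_iff]
  split_ifs at h <;> omega

theorem exists_dual (a : PBWColumn n) :
    ∃ b : PBWColumn n, b.entries = (a.entries.image dualLetter)ᶜ := by
  have h1 := a.len_pos
  have h2 := a.len_lt
  have h3 : (a.entries.image dualLetter)ᶜ.card = n - a.len := by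
    rw [Finset.card_compl, Finset.card_image_of_injective _ dualLetter_injective, card_entries,
      Fintype.card_fin]
  exact exists_entries_eq _ (Finset.card_pos.1 (by omega)) (by omega)

/-- The dual column, corresponding to complementary minors. -/
noncomputable def dual (a : PBWColumn n) : PBWColumn n := a.exists_dual.choose

theorem entries_dual (a : PBWColumn n) : a.dual.entries = (a.entries.image dualLetter)ᶜ :=
  a.exists_dual.choose_spec

theorem len_dual (a : PBWColumn n) : a.dual.len + a.len = n := by
  have := a.len_lt
  rw [← card_entries a.dual, entries_dual, Finset.card_compl,
    Finset.card_image_of_injective _ dualLetter_injective, card_entries, Fintype.card_fin]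
  omega

/-- The relabelling reflects the letters below `n - 1`, and a window `[s, m)` with `m < n` contains
no others. Its complement count turns the cardinality criterion for the dual into the negated
criterion for `a` on the reflected window. -/
theorem lt_prof_dual_iff (a : PBWColumn n) {s m : ℕ} (hsm : s ≤ m) (hm : m < n) :
    m < a.dual.prof s ↔ ¬ n - 1 - s < a.prof (n - 1 - m) := by
  rw [lt_prof_iff_card_entries, lt_prof_iff_card_entries, entries_dual]
  have h1 : (Finset.univ.filter fun x : Fin n => s ≤ (x : ℕ) ∧ (x : ℕ) < m).card = m - s := by
    rw [← Finset.card_image_of_injective _ Fin.val_injective, ← Nat.card_Ico]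
    congr 1
    ext x
    simp only [Finset.mem_image, Finset.mem_filter, Finset.mem_univ, true_and, Finset.mem_Ico]
    exact ⟨by rintro ⟨c, hc, rfl⟩; exact hc, fun h => ⟨⟨x, by omega⟩, h, rfl⟩⟩
  have h2 := Finset.card_filter_add_card_filter_not
    (s := Finset.univ.filter fun x : Fin n => s ≤ (x : ℕ) ∧ (x : ℕ) < m)
    fun x => x ∈ a.entries.image dualLetter
  have h3 : ((a.entries.image dualLetter)ᶜ.filter fun x : Fin n => s ≤ (x : ℕ) ∧ (x : ℕ) < m) =
      (Finset.univ.filter fun x : Fin n => s ≤ (x : ℕ) ∧ (x : ℕ) < m).filter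
        fun x => x ∉ a.entries.image dualLetter := by
    ext x
    simp only [Finset.mem_filter, Finset.mem_compl, Finset.mem_univ, true_and]
    exact and_comm
  have h4 : ((Finset.univ.filter fun x : Fin n => s ≤ (x : ℕ) ∧ (x : ℕ) < m).filter
        fun x => x ∈ a.entries.image dualLetter) =
      (a.entries.filter fun x : Fin n => n - 1 - m ≤ (x : ℕ) ∧ (x : ℕ) < n - 1 - s).image
        dualLetter := by
    ext x
    simp only [Finset.mem_filter, Finset.mem_image, Finset.mem_univ, true_and]
    constructor
    · rintro ⟨hx, y, hy, rfl⟩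
      refine ⟨y, ⟨hy, ?_⟩, rfl⟩
      rw [val_dualLetter] at hx
      have := y.2
      split_ifs at hx <;> omega
    · rintro ⟨y, ⟨hy, hy'⟩, rfl⟩
      refine ⟨?_, y, hy, rfl⟩
      rw [val_dualLetter]
      have := y.2
      split_ifs <;> omega
  rw [h4, Finset.card_image_of_injective _ dualLetter_injective, h1] at h2
  rw [h3]
  have := a.len_dual
  omega

/-- The omitted cases `m < s` follow from the diagonal ones: `m < a.prof s` forces `s < a.len`,
hence `s < a.prof s`. So the range covered by `lt_prof_dual_iff` suffices. -/
theorem le_iff_lt_prof_of_le {a b : PBWColumn n} :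
    a ≤ b ↔ ∀ s m, s ≤ m → m < n → m < a.prof s → m < b.prof s := by
  rw [le_iff_lt_prof]
  refine ⟨fun h s m _ _ => h s m, fun h s m hm => ?_⟩
  rcases le_total s m with hsm | hsm
  · exact h s m hsm (hm.trans_le (a.prof_le s)) hm
  · have hs : s < a.len := by
      by_contra hs
      rw [a.prof_eq_zero (by omega)] at hm
      exact Nat.not_lt_zero _ hm
    exact hsm.trans_lt (h s s le_rfl (hs.trans a.len_lt) (hs.trans_le (a.len_le_prof hs)))

theorem dual_le_dual_iff {a b : PBWColumn n} : b.dual ≤ a.dual ↔ a ≤ b := by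
  rw [le_iff_lt_prof_of_le, le_iff_lt_prof_of_le]
  constructor
  · intro h s m hsm hm hlt
    by_contra hb
    have h1 : n - 1 - s < b.dual.prof (n - 1 - m) := by
      rw [lt_prof_dual_iff b (by omega) (by omega)]
      rwa [show n - 1 - (n - 1 - m) = m by omega, show n - 1 - (n - 1 - s) = s by omega]
    have h2 := h _ _ (by omega) (by omega) h1
    rw [lt_prof_dual_iff a (by omega) (by omega), show n - 1 - (n - 1 - m) = m by omega,
      show n - 1 - (n - 1 - s) = s by omega] at h2
    exact h2 hlt
  · intro h s m hsm hm hlt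
    rw [lt_prof_dual_iff _ hsm hm] at hlt ⊢
    exact fun hc => hlt (h _ _ (by omega) (by omega) hc)

theorem dual_injective : Function.Injective (dual (n := n)) := fun _ _ h =>
  le_antisymm (dual_le_dual_iff.1 h.ge) (dual_le_dual_iff.1 h.le)

theorem dual_bijective : Function.Bijective (dual (n := n)) :=
  Finite.injective_iff_bijective.1 dual_injective

/-- Plücker coordinates indexed by dual columns are, up to constants, Plücker coordinates of
another matrix. -/
theorem exists_plueckerCoord_dual (n : ℕ) : ∃ ε : PBWColumn n → ℂ, (∀ a, ε a ≠ 0) ∧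
    ∀ g : Matrix (Fin n) (Fin n) ℂ, IsUnit g.det → ∃ g' : Matrix (Fin n) (Fin n) ℂ,
      ∀ a, plueckerCoord g a.dual = ε a * plueckerCoord g' a := by
  have hcols : ∀ a : PBWColumn n, ∃ e : Fin a.dual.len ⊕ Fin a.len ≃ Fin n,
      (∀ c, e (Sum.inl c) = a.dual.entry c) ∧ ∀ c, e (Sum.inr c) = dualLetter (a.entry c) := by
    intro a
    have hinj : Function.Injective
        (Sum.elim a.dual.entry fun c => dualLetter (a.entry c)) := by
      refine a.dual.entry_injective.sumElim (dualLetter_injective.comp a.entry_injective) ?_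
      intro c d h
      have h1 : a.dual.entry c ∈ a.dual.entries := a.dual.mem_entries.2 ⟨c, rfl⟩
      rw [entries_dual, Finset.mem_compl, h] at h1
      exact h1 (Finset.mem_image_of_mem _ (a.mem_entries.2 ⟨d, rfl⟩))
    exact ⟨Equiv.ofBijective _ ((Fintype.bijective_iff_injective_and_card _).2
      ⟨hinj, by simp [a.len_dual]⟩), fun _ => rfl, fun _ => rfl⟩
  have hrows : ∀ a : PBWColumn n, ∃ f : Fin a.dual.len ⊕ Fin a.len ≃ Fin n,
      (∀ c, f (Sum.inl c) = Fin.castLE a.dual.len_lt.le c) ∧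
        ∀ c, f (Sum.inr c) = Fin.rev (Fin.castLE a.len_lt.le c) := by
    intro a
    have hlen := a.len_dual
    have hinj : Function.Injective (Sum.elim (Fin.castLE a.dual.len_lt.le)
        fun c => Fin.rev (Fin.castLE a.len_lt.le c)) := by
      refine (Fin.castLE_injective _).sumElim
        (Fin.rev_injective.comp (Fin.castLE_injective _)) ?_
      intro c d h
      have hc := c.2
      have hd := d.2
      rw [Fin.ext_iff, Fin.val_rev] at h
      simp only [Fin.val_castLE] at h
      omega
    exact ⟨Equiv.ofBijective _ ((Fintype.bijective_iff_injective_and_card _).2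
      ⟨hinj, by simp [a.len_dual]⟩), fun _ => rfl, fun _ => rfl⟩
  choose e he1 he2 using hcols
  choose f hf1 hf2 using hrows
  refine ⟨fun a => ((Equiv.Perm.sign ((f a).symm.trans (e a)) : ℤˣ) : ℤ), fun a => ?_,
    fun g hg => ?_⟩
  · exact Int.cast_ne_zero.2 (Units.ne_zero _)
  let g₀ : Matrix (Fin n) (Fin n) ℂ := Matrix.of fun i x => g⁻¹ (dualLetter x) (Fin.rev i)
  -- Jacobi's theorem produces a factor `g.det` for every size of minor. Scaling the first row
  -- absorbs it, since each Plücker coordinate uses that row exactly once.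
  refine ⟨Matrix.of fun i x => (if (i : ℕ) = 0 then g.det else 1) * g₀ i x, fun a => ?_⟩
  have hdet : (g.submatrix (f a) (e a)).det =
      ((Equiv.Perm.sign ((f a).symm.trans (e a)) : ℤˣ) : ℤ) * g.det := by
    rw [← Matrix.det_permute', ← Matrix.det_submatrix_equiv_self (f a)]
    congr 1
    ext i j
    simp
  have hmul : g.submatrix (f a) (e a) * g⁻¹.submatrix (e a) (f a) = 1 := by
    rw [Matrix.submatrix_mul_equiv, Matrix.mul_nonsing_inv g hg, Matrix.submatrix_one_equiv]
  have hJ := Matrix.det_toBlocks₁₁_eq_of_mul_eq_one hmul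
  have h11 : (g.submatrix (f a) (e a)).toBlocks₁₁ =
      g.submatrix (Fin.castLE a.dual.len_lt.le) a.dual.entry := by
    ext i j
    simp [Matrix.toBlocks₁₁, hf1, he1]
  have h22 : (g⁻¹.submatrix (e a) (f a)).toBlocks₂₂ =
      (g₀.submatrix (Fin.castLE a.len_lt.le) a.entry).transpose := by
    ext i j
    simp [Matrix.toBlocks₂₂, hf2, he2, g₀]
  have hscale : plueckerCoord (Matrix.of fun i x =>
      (if (i : ℕ) = 0 then g.det else 1) * g₀ i x) a = g.det * plueckerCoord g₀ a := by
    have h1 := Matrix.det_mul_column (fun i : Fin a.len => if (i : ℕ) = 0 then g.det else 1)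
      (g₀.submatrix (Fin.castLE a.len_lt.le) a.entry)
    have h2 : ∏ i : Fin a.len, (if (i : ℕ) = 0 then g.det else 1) = g.det := by
      rw [Finset.prod_eq_single ⟨0, a.len_pos⟩]
      · simp
      · intro i _ hi
        rw [if_neg fun h => hi (Fin.ext h)]
      · exact fun h => (h (Finset.mem_univ _)).elim
    rw [h2] at h1
    exact h1
  rw [h11, h22, Matrix.det_transpose, hdet] at hJ
  rw [hscale]
  refine Eq.trans hJ ?_
  rw [mul_assoc]
  rfl

open MvPolynomial

/-- Duality sends the relation to one for `a.dual` and `b.dual`, up to nonzero constants. As it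
reverses the order, the join bound there is the meet bound here. -/
theorem le_inf_of_mem_support {a b : PBWColumn n} {c : PBWColumn n × PBWColumn n →₀ ℂ}
    (hc : ∀ p ∈ c.support, p.1 ≤ p.2) (hrel : X a * X b - quadForm c ∈ plueckerIdeal n)
    {p : PBWColumn n × PBWColumn n} (hp : p ∈ c.support) : p.1 ≤ a ⊓ b := by
  have := Fintype.ofFinite (PBWColumn n)
  obtain ⟨ε, hε, hdual⟩ := exists_plueckerCoord_dual n
  let ψ : PlueckerRing n →ₐ[ℂ] PlueckerRing n := aeval fun a => C (ε a)⁻¹ * X a.dual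
  have hψ : ∀ q ∈ plueckerIdeal n, ψ q ∈ plueckerIdeal n := by
    intro q hq
    refine mem_plueckerIdeal_iff.2 fun g hg => ?_
    obtain ⟨g', hg'⟩ := hdual g hg
    have h1 := aeval_plueckerCoord_eq_zero g' hq
    have h2 : (aeval (plueckerCoord g)).comp ψ = aeval (R := ℂ) (plueckerCoord g') := by
      refine MvPolynomial.algHom_ext fun a => ?_
      rw [AlgHom.comp_apply, aeval_X, aeval_X, map_mul, aeval_X, hg', aeval_C]
      exact inv_mul_cancel_left₀ (hε a) _
    rw [← h2, AlgHom.comp_apply] at h1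
    exact h1
  -- The factors are swapped so that dual pairs are again listed in increasing order.
  let φ : PBWColumn n × PBWColumn n ≃ PBWColumn n × PBWColumn n :=
    (Equiv.prodComm _ _).trans
      ((Equiv.ofBijective _ dual_bijective).prodCongr (Equiv.ofBijective _ dual_bijective))
  have hφ : ∀ q, φ q = (q.2.dual, q.1.dual) := fun q => rfl
  let c' : PBWColumn n × PBWColumn n →₀ ℂ := Finsupp.equivFunOnFinite.symm fun q =>
    c (φ.symm q) * ((ε (φ.symm q).1)⁻¹ * (ε (φ.symm q).2)⁻¹)
  have hc'φ : ∀ q, c' (φ q) = c q * ((ε q.1)⁻¹ * (ε q.2)⁻¹) := by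
    intro q
    change c (φ.symm (φ q)) * _ = _
    rw [Equiv.symm_apply_apply]
  have hmem : ∀ q, φ q ∈ c'.support ↔ q ∈ c.support := by
    intro q
    rw [Finsupp.mem_support_iff, Finsupp.mem_support_iff, hc'φ, mul_ne_zero_iff]
    exact and_iff_left (mul_ne_zero (inv_ne_zero (hε _)) (inv_ne_zero (hε _)))
  have hc' : ∀ q ∈ c'.support, q.1 ≤ q.2 := by
    intro q hq
    rw [← φ.apply_symm_apply q, hmem] at hq
    rw [← φ.apply_symm_apply q, hφ]
    exact dual_le_dual_iff.2 (hc _ hq)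
  have hquad : ψ (quadForm c) = quadForm c' := by
    rw [quadForm, quadForm, Finsupp.sum_fintype _ _ (by simp), Finsupp.sum_fintype _ _ (by simp),
      map_sum]
    refine Fintype.sum_equiv φ _ _ fun q => ?_
    rw [hc'φ, hφ]
    simp only [map_mul, ψ, aeval_C, aeval_X, algebraMap_eq]
    ring
  have hrel' : C ((ε a)⁻¹ * (ε b)⁻¹) * (X a.dual * X b.dual) - quadForm c' ∈ plueckerIdeal n := by
    have h1 := hψ _ hrel
    rw [map_sub, hquad] at h1
    convert h1 using 2
    simp only [map_mul, ψ, aeval_X]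
    ring
  have hle := sup_le_of_leadExp_le (hc' _ ((hmem p).2 hp))
    (leadExp_le_of_mem_support hc' hrel' ((hmem p).2 hp))
  rw [hφ] at hle
  exact le_inf (dual_le_dual_iff.1 (le_sup_left.trans hle))
    (dual_le_dual_iff.1 (le_sup_right.trans hle))

end PBWColumn

/-! ### Join-irreducible columns and the operation `⊙` -/

namespace PBWColumn

variable {n : ℕ}

/-- The profile of `p` is a rectangle: constant equal to `m + 1` on the positions up to `s`. -/
def IsRect (p : PBWColumn n) (s m : ℕ) : Prop := ∀ r, p.prof r = if r ≤ s then m + 1 else 0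

theorem lt_len_iff_prof_pos (a : PBWColumn n) {r : ℕ} : r < a.len ↔ 0 < a.prof r := by
  refine ⟨fun h => lt_of_lt_of_le a.len_pos (a.len_le_prof h), fun h => ?_⟩
  by_contra hr
  rw [a.prof_eq_zero (not_lt.1 hr)] at h
  exact lt_irrefl _ h

theorem exists_isRect {s m : ℕ} (hsm : s ≤ m) (hm : m < n) (hs : s + 1 < n) :
    ∃ p : PBWColumn n, p.IsRect s m := by
  obtain ⟨p, hp⟩ := exists_prof_eq (n := n) (f := fun r => if r ≤ s then m + 1 else 0)
    ⟨s + 1, by omega, hs, fun r t h => by simp only; split_ifs <;> omega,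
      fun r => by simp only; split_ifs <;> omega,
      fun r hr => by simp only; rw [if_pos (by omega)]; omega, fun r hr => if_neg (by omega)⟩
  exact ⟨p, fun r => congrFun hp r⟩

namespace IsRect

variable {p q a : PBWColumn n} {s m s' m' : ℕ}

theorem prof_self (hp : p.IsRect s m) : p.prof s = m + 1 := by rw [hp s, if_pos le_rfl]

theorem le_iff (hp : p.IsRect s m) : p ≤ a ↔ m < a.prof s := by
  rw [le_iff_prof]
  constructor
  · intro h
    have := h s
    rw [hp.prof_self] at this
    exact this
  · intro h r
    rw [hp r]
    split_ifs with hr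
    · exact Nat.succ_le_of_lt (h.trans_le (a.prof_antitone hr))
    · exact Nat.zero_le _

theorem le_iff_rect (hp : p.IsRect s m) (hq : q.IsRect s' m') : p ≤ q ↔ s ≤ s' ∧ m ≤ m' := by
  rw [hp.le_iff, hq s]
  split_ifs with h <;> omega

theorem len_eq (hp : p.IsRect s m) : p.len = s + 1 := by
  refine eq_of_forall_lt_iff fun r => ?_
  rw [lt_len_iff_prof_pos, hp r]
  split_ifs <;> omega

theorem mem_orderPart_iff (hp : p.IsRect s m) (hm : 0 < m) : p ∈ orderPart n ↔ s = m := by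
  have hlen := hp.len_eq
  have hentry : ∀ r : Fin p.len, (p.entry r : ℕ) = if (r : ℕ) = s then m else r := by
    intro r
    have hr := r.2
    rw [p.entry_eq, hp, hp, if_pos (show (r : ℕ) ≤ s by omega)]
    split_ifs <;> omega
  constructor
  · intro h
    have h1 := h.2 ⟨s, by omega⟩
    rw [hentry, if_pos rfl] at h1
    exact h1.symm
  · rintro rfl
    refine ⟨by omega, fun r => ?_⟩
    rw [hentry]
    split_ifs <;> omega

theorem supIrred (hp : p.IsRect s m) (hm : 0 < m) : SupIrred p := by
  have hlen := hp.len_eq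
  have hlt := p.len_lt
  constructor
  · intro hmin
    obtain ⟨q, hq⟩ := exists_isRect (n := n) (s := 0) (m := 0) le_rfl (by omega) (by omega)
    have h1 : q ≤ p := (hq.le_iff_rect hp).2 ⟨Nat.zero_le _, Nat.zero_le _⟩
    have := ((hp.le_iff_rect hq).1 (hmin h1)).2
    omega
  · intro b c hbc
    have h1 := prof_sup b c s
    rw [hbc, hp.prof_self] at h1
    rcases le_total (b.prof s) (c.prof s) with h | h
    · rw [max_eq_right h] at h1
      exact Or.inr (le_antisymm (hbc ▸ le_sup_right) (hp.le_iff.2 (by omega)))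
    · rw [max_eq_left h] at h1
      exact Or.inl (le_antisymm (hbc ▸ le_sup_left) (hp.le_iff.2 (by omega)))

end IsRect

/-- The join-irreducible columns are the rectangles. -/
theorem exists_isRect_of_supIrred {p : PBWColumn n} (hp : SupIrred p) :
    ∃ s m, s ≤ m ∧ 0 < m ∧ m < n ∧ p.IsRect s m := by
  have hlen := p.len_pos
  have hlt := p.len_lt
  set s := p.len - 1 with hs
  set M := p.prof s with hM
  have hMlen : p.len ≤ M := p.len_le_prof (by omega)
  have hMn : M ≤ n := p.prof_le s
  have hrect : p.IsRect s (M - 1) := by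
    obtain ⟨q, hq⟩ := exists_isRect (n := n) (s := s) (m := M - 1) (by omega) (by omega) (by omega)
    have hqp : q ≤ p := hq.le_iff.2 (by omega)
    by_cases hall : p.prof 0 ≤ M
    · have : p ≤ q := by
        rw [le_iff_prof]
        intro r
        rw [hq r]
        split_ifs with hr
        · have := p.prof_antitone (Nat.zero_le r)
          omega
        · rw [p.prof_eq_zero (by omega)]
      rwa [le_antisymm this hqp]
    · exfalso
      have hex : ∃ k, p.prof k ≤ M := ⟨s, le_rfl⟩
      classical
      set k := Nat.find hex with hk
      have hk1 : p.prof k ≤ M := Nat.find_spec hex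
      have hk2 : ∀ r < k, M < p.prof r := fun r hr => not_le.1 (Nat.find_min hex hr)
      have hk0 : 1 ≤ k := by
        by_contra h0
        rw [show k = 0 by omega] at hk1
        exact hall hk1
      have hks : k ≤ s := Nat.find_min' hex le_rfl
      -- A nonconstant profile is the join of the rectangle `q` of its bottom value and its
      -- truncation before the first position with a value at most `M`; neither is all of `p`.
      obtain ⟨p', hp'⟩ := exists_prof_eq (n := n) (f := fun r => if r < k then p.prof r else 0)
        ⟨k, hk0, by omega, fun r t h => by
            have := p.prof_antitone h
            simp only
            split_ifs <;> omega,
          fun r => by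
            have := p.prof_le r
            simp only
            split_ifs <;> omega,
          fun r hr => by
            have := hk2 r hr
            simp only
            rw [if_pos hr]
            omega, fun r hr => if_neg (by omega)⟩
      have hp'r : ∀ r, p'.prof r = if r < k then p.prof r else 0 := fun r => congrFun hp' r
      have hsup : q ⊔ p' = p := by
        refine prof_injective (funext fun r => ?_)
        rw [prof_sup, hq r, hp'r r]
        by_cases hrk : r < k
        · have := hk2 r hrk
          rw [if_pos (by omega), if_pos hrk, max_eq_right (by omega)]
        · rw [if_neg hrk]
          by_cases hrs : r ≤ s
          · have h1 := p.prof_antitone (not_lt.1 hrk)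
            have h2 := p.prof_antitone hrs
            rw [if_pos hrs]
            omega
          · rw [if_neg hrs, p.prof_eq_zero (by omega), max_self]
      rcases hp.2 hsup with h | h
      · have h1 := hq 0
        rw [h, if_pos (Nat.zero_le _)] at h1
        omega
      · have h1 := hp'r k
        rw [h, if_neg (lt_irrefl _)] at h1
        have h2 := p.prof_antitone hks
        omega
  refine ⟨s, M - 1, by omega, ?_, by omega, hrect⟩
  by_contra hm
  -- Corner `(0, 0)` gives the least column, which is not join-irreducible.
  refine hp.1 fun q _ => hrect.le_iff.2 ?_
  have := q.len_pos
  have h1 := q.len_le_prof this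
  rw [show s = 0 by omega]
  omega

/-- The diagonal rectangles below `a` record its length. An off-diagonal rectangle is maximal when
neither its width nor its height can grow, so it marks a corner of the profile, that is, a letter
exceeding its position. -/
theorem mem_interpSet_iff {p a : PBWColumn n} {s m : ℕ} (hp : p.IsRect s m) (hsm : s ≤ m)
    (hm : 0 < m) : p ∈ interpSet (orderPart n) (irredIdeal a) ↔
      (s = m ∧ s < a.len) ∨ (s < m ∧ ∃ c : Fin a.len, s = c ∧ m = a.entry c) := by
  have hirr := hp.supIrred hm
  rcases hsm.eq_or_lt with rfl | hlt
  · have h1 : p ∈ orderPart n := (hp.mem_orderPart_iff hm).2 rfl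
    have h2 : p ≤ a ↔ s < a.len := by
      rw [hp.le_iff]
      exact ⟨fun h => a.lt_len_iff_prof_pos.2 (by omega), fun h => h.trans_le (a.len_le_prof h)⟩
    simp only [interpSet, irredIdeal, Set.mem_ofPred_eq, hirr, h1, h2, true_and, true_or, and_true,
      lt_irrefl, false_and, or_false]
  · have h1 : p ∉ orderPart n := fun h => hlt.ne ((hp.mem_orderPart_iff hm).1 h)
    simp only [interpSet, irredIdeal, Set.mem_ofPred_eq, hirr, h1, true_and, false_or, hlt.ne,
      false_and, hlt]
    constructor
    · rintro ⟨hpa, hmax⟩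
      rw [hp.le_iff] at hpa
      have hsa : s < a.len := a.lt_len_iff_prof_pos.2 (by omega)
      have halt := a.len_lt
      have hprof : a.prof s ≤ m + 1 := by
        by_contra hc
        have := a.prof_le s
        obtain ⟨q, hq⟩ := exists_isRect (n := n) (s := s) (m := m + 1) (by omega) (by omega)
          (by omega)
        refine hmax q ⟨hq.supIrred (by omega), hq.le_iff.2 (by omega)⟩ (lt_of_le_not_ge
          ((hp.le_iff_rect hq).2 ⟨le_rfl, by omega⟩) fun h => ?_)
        have := ((hq.le_iff_rect hp).1 h).2
        omega
      have hprof' : a.prof (s + 1) ≤ m := by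
        by_contra hc
        have := a.prof_le s
        have hsa' : s + 1 < a.len := a.lt_len_iff_prof_pos.2 (by omega)
        obtain ⟨q, hq⟩ := exists_isRect (n := n) (s := s + 1) (m := m) (by omega) (by omega)
          (by omega)
        refine hmax q ⟨hq.supIrred (by omega), hq.le_iff.2 (by omega)⟩ (lt_of_le_not_ge
          ((hp.le_iff_rect hq).2 ⟨by omega, le_rfl⟩) fun h => ?_)
        have := ((hq.le_iff_rect hp).1 h).1
        omega
      refine ⟨⟨s, hsa⟩, rfl, ?_⟩
      rw [a.entry_eq, if_pos (by simp only; omega)]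
      simp only
      omega
    · rintro ⟨c, rfl, rfl⟩
      have hlen : a.len ≤ a.entry c := by
        by_contra hc
        have := a.fixed c (by omega)
        omega
      have hprof' : a.prof (c + 1) ≤ a.entry c := by
        refine (a.prof_le_iff).2 fun d hd => ?_
        by_cases hd' : a.len ≤ (a.entry d : ℕ)
        · have := a.decr c d (Fin.lt_def.2 (by omega)) hlen hd'
          rw [Fin.lt_def] at this
          omega
        · omega
      have hprof := a.prof_succ c
      refine ⟨hp.le_iff.2 (by omega), fun q hq hpq => ?_⟩
      obtain ⟨s', m', -, -, -, hq'⟩ := exists_isRect_of_supIrred hq.1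
      have h2 := (hp.le_iff_rect hq').1 hpq.le
      have h3 := hq'.le_iff.1 hq.2
      rcases h2.1.eq_or_lt with h4 | h4
      · rw [← h4] at h3 hq'
        refine hpq.not_ge ((hq'.le_iff_rect hp).2 ⟨le_rfl, by omega⟩)
      · have := a.prof_antitone (Nat.succ_le_of_lt h4)
        simp only [Nat.succ_eq_add_one] at this
        omega

theorem irredIdeal_sup {L : Type*} [DistribLattice L] (a b : L) :
    irredIdeal (a ⊔ b) = irredIdeal a ∪ irredIdeal b := by
  ext p
  simp only [irredIdeal, Set.mem_union, Set.mem_ofPred_eq]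
  constructor
  · rintro ⟨hp, hle⟩
    exact ((supPrime_iff_supIrred.2 hp).2 hle).imp (fun h => ⟨hp, h⟩) fun h => ⟨hp, h⟩
  · rintro (⟨hp, hle⟩ | ⟨hp, hle⟩)
    · exact ⟨hp, hle.trans le_sup_left⟩
    · exact ⟨hp, hle.trans le_sup_right⟩

/-- The number of letters that are at least `m` at or below position `s`. -/
def tailCount (a : PBWColumn n) (s m : ℕ) : ℕ :=
  (Finset.univ.filter fun c : Fin a.len => s ≤ (c : ℕ) ∧ m ≤ (a.entry c : ℕ)).card

theorem tailCount_zero (a : PBWColumn n) (s : ℕ) : a.tailCount s 0 = a.len - s := by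
  rw [← card_filter_le_val, tailCount]
  congr 1
  ext c
  simp

/-- The mixed second difference of the counts isolates the letter `m` at position `s`. -/
theorem tailCount_add_tailCount (a : PBWColumn n) (s m : ℕ) :
    a.tailCount s m + a.tailCount (s + 1) (m + 1) =
      a.tailCount (s + 1) m + a.tailCount s (m + 1) +
        (Finset.univ.filter fun c : Fin a.len => s = (c : ℕ) ∧ m = (a.entry c : ℕ)).card := by
  simp only [tailCount, Finset.card_filter, ← Finset.sum_add_distrib]
  refine Finset.sum_congr rfl fun c _ => ?_
  split_ifs <;> omega

theorem card_filter_eq_pos_eq (a : PBWColumn n) (s m : ℕ) [Decidable (∃ c : Fin a.len,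
    s = c ∧ m = a.entry c)] :
    (Finset.univ.filter fun c : Fin a.len => s = (c : ℕ) ∧ m = (a.entry c : ℕ)).card =
      if ∃ c : Fin a.len, s = c ∧ m = a.entry c then 1 else 0 := by
  split_ifs with h
  · obtain ⟨c, hc, hc'⟩ := h
    refine Finset.card_eq_one.2 ⟨c, ?_⟩
    ext d
    simp only [Finset.mem_filter, Finset.mem_univ, true_and, Finset.mem_singleton]
    exact ⟨fun hd => Fin.ext (hd.1.symm.trans hc), by rintro rfl; exact ⟨hc, hc'⟩⟩
  · exact Finset.card_eq_zero.2 (Finset.filter_eq_empty_iff.2 fun d _ hd => h ⟨d, hd⟩)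

theorem tailCount_add_eq {a b g h : PBWColumn n}
    (heq : g.leadExp + h.leadExp = a.leadExp + b.leadExp) (s m : ℕ) :
    g.tailCount s m + h.tailCount s m = a.tailCount s m + b.tailCount s m := by
  have hzero : ∀ c : PBWColumn n, ¬ (s < n ∧ m < n) → c.tailCount s m = 0 := by
    intro c hc
    refine Finset.card_eq_zero.2 (Finset.filter_eq_empty_iff.2 fun d _ hd => hc ?_)
    have := d.2
    have := c.len_lt
    have := (c.entry d).2
    omega
  by_cases hsm : s < n ∧ m < n
  · have := DFunLike.congr_fun heq (⟨s, hsm.1⟩, ⟨m, hsm.2⟩)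
    rw [Finsupp.add_apply, Finsupp.add_apply, leadExp_apply, leadExp_apply, leadExp_apply,
      leadExp_apply] at this
    exact this
  · simp only [hzero _ hsm]

/-- The two sides have supports the region under `h` and the union of the regions under `a` and `b`.
-/
theorem eq_sup_of_leadExp_add_eq {a b g h : PBWColumn n} (hgh : g ≤ h)
    (heq : g.leadExp + h.leadExp = a.leadExp + b.leadExp) : h = a ⊔ b := by
  refine le_antisymm (le_iff_leadExp.2 fun p hp => ?_) (sup_le_of_leadExp_le hgh heq.ge)
  rw [← leadExp_add_pos_iff hgh, heq, Finsupp.add_apply, add_pos_iff] at hp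
  exact hp.elim (leadExp_pos_of_le le_sup_left) (leadExp_pos_of_le le_sup_right)

/-- Values of `leadExp` are tail counts, and each indicator of `K(ι x)` is a difference of tail
counts: a first difference on the diagonal, a mixed second one off it. Equality of the sums thus
passes to the indicators. -/
theorem isOdot_of_leadExp_add_eq {a b g h : PBWColumn n} (hgh : g ≤ h)
    (heq : g.leadExp + h.leadExp = a.leadExp + b.leadExp) : IsOdot (orderPart n) a b g := by
  classical
  rw [IsOdot, ← irredIdeal_sup, ← eq_sup_of_leadExp_add_eq hgh heq]
  funext p
  simp only [Pi.add_apply, Set.indicator_apply, Pi.one_apply]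
  by_cases hp : SupIrred p
  · obtain ⟨s, m, hsm, hm, -, hrect⟩ := exists_isRect_of_supIrred hp
    simp only [mem_interpSet_iff hrect hsm hm]
    have hT := tailCount_add_eq heq
    rcases hsm.eq_or_lt with rfl | hlt
    · have h1 := hT s 0
      have h2 := hT (s + 1) 0
      simp only [tailCount_zero] at h1 h2
      simp only [true_and, lt_irrefl, false_and, or_false]
      split_ifs <;> omega
    · simp only [hlt.ne, hlt, false_and, true_and, false_or, ← card_filter_eq_pos_eq]
      have h1 := hT s m
      have h2 := hT (s + 1) m
      have h3 := hT s (m + 1)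
      have h4 := hT (s + 1) (m + 1)
      have ha := a.tailCount_add_tailCount s m
      have hb := b.tailCount_add_tailCount s m
      have hg := g.tailCount_add_tailCount s m
      have hh := h.tailCount_add_tailCount s m
      omega
  · have hnot : ∀ c : PBWColumn n, p ∉ interpSet (orderPart n) (irredIdeal c) :=
      fun c hc => hp hc.1.1
    simp only [hnot, if_false]

end PBWColumn

/-! ### Existence, uniqueness and shape of straightening relations -/

open MvPolynomial

theorem isStandardMonomial_pair {Ω : Type*} [PartialOrder Ω] {g h : Ω} (hgh : g ≤ h) :
    IsStandardMonomial (Finsupp.single g 1 + Finsupp.single h 1) := by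
  classical
  have hmem : ∀ x ∈ (Finsupp.single g 1 + Finsupp.single h 1 : Ω →₀ ℕ).support, x = g ∨ x = h := by
    intro x hx
    rcases Finset.mem_union.1 (Finsupp.support_add hx) with h' | h'
    · exact Or.inl (Finset.mem_singleton.1 (Finsupp.support_single_subset h'))
    · exact Or.inr (Finset.mem_singleton.1 (Finsupp.support_single_subset h'))
  intro x hx y hy
  rcases hmem x hx with rfl | rfl <;> rcases hmem y hy with rfl | rfl <;> simp [hgh]

theorem not_isStandardMonomial_pair {Ω : Type*} [PartialOrder Ω] {a b : Ω} (hab : ¬ a ≤ b)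
    (hba : ¬ b ≤ a) : ¬ IsStandardMonomial (Finsupp.single a 1 + Finsupp.single b 1) := by
  intro h
  rcases h a (by simp) b (by simp) with h | h
  exacts [hab h, hba h]

theorem X_mul_X_eq_monomial {Ω : Type*} (a b : Ω) :
    (X a * X b : MvPolynomial Ω ℂ) = monomial (Finsupp.single a 1 + Finsupp.single b 1) 1 := by
  rw [X, X, monomial_mul, one_mul]

namespace PBWColumn

variable {n : ℕ}

theorem mk_monomial (d : PBWColumn n →₀ ℕ) :
    Ideal.Quotient.mk (plueckerIdeal n) (monomial d 1) =
      d.prod fun ω k => Ideal.Quotient.mk (plueckerIdeal n) (X ω) ^ k := by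
  rw [monomial_eq, C_1, one_mul, Finsupp.prod, Finsupp.prod, map_prod]
  simp only [map_pow]

theorem eq_zero_of_mem_plueckerIdeal {q : PlueckerRing n} (hq : q ∈ plueckerIdeal n)
    (hstd : ∀ d ∈ q.support, IsStandardMonomial d) : q = 0 := by
  classical
  have h := (linearIndependent_iff'.1 (linearIndependent_standard n))
    (q.support.subtype IsStandardMonomial) (fun d => coeff d.1 q) ?_
  · refine MvPolynomial.ext _ _ fun d => ?_
    by_contra hd
    rw [coeff_zero] at hd
    have hd' := mem_support_iff.2 hd
    exact hd (h ⟨d, hstd d hd'⟩ (Finset.mem_subtype.2 hd'))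
  · simp only [← mk_monomial]
    rw [Finset.sum_subtype_of_mem
      (fun d => coeff d q • Ideal.Quotient.mk (plueckerIdeal n) (monomial d 1)) hstd]
    have : ∑ d ∈ q.support, coeff d q • Ideal.Quotient.mk (plueckerIdeal n) (monomial d 1) =
        Ideal.Quotient.mk (plueckerIdeal n) (∑ d ∈ q.support, monomial d (coeff d q)) := by
      rw [map_sum]
      refine Finset.sum_congr rfl fun d _ => ?_
      rw [← mul_one (coeff d q), ← smul_eq_mul, ← smul_monomial, smul_eq_mul, mul_one]
      rfl
    rw [this, support_sum_monomial_coeff]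
    exact Ideal.Quotient.eq_zero_iff_mem.2 hq

/-- Spanning for the generic matrix, lifted to the polynomial ring. The multiset of letters is kept
because it later makes the term with larger factor `a ⊔ b` unique. -/
theorem exists_quadForm (a b : PBWColumn n) : ∃ c : PBWColumn n × PBWColumn n →₀ ℂ,
    (∀ p ∈ c.support, p.1 ≤ p.2 ∧
      p.1.entries.val + p.2.entries.val = a.entries.val + b.entries.val) ∧
    X a * X b - quadForm c ∈ plueckerIdeal n := by
  set Z := Matrix.mvPolynomialX (Fin n) (Fin n) ℂ
  have h := plueckerCoord_mul_mem_span_standard Z a b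
  have himage : {x | ∃ g h : PBWColumn n, g ≤ h ∧
        g.entries.val + h.entries.val = a.entries.val + b.entries.val ∧
        x = plueckerCoord Z g * plueckerCoord Z h} =
      (fun p : PBWColumn n × PBWColumn n => plueckerCoord Z p.1 * plueckerCoord Z p.2) ''
        {p | p.1 ≤ p.2 ∧
          p.1.entries.val + p.2.entries.val = a.entries.val + b.entries.val} := by
    ext x
    constructor
    · rintro ⟨g, h, h1, h2, rfl⟩
      exact ⟨(g, h), ⟨h1, h2⟩, rfl⟩
    · rintro ⟨p, hp, rfl⟩
      exact ⟨p.1, p.2, hp.1, hp.2, rfl⟩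
  rw [himage, Finsupp.mem_span_image_iff_linearCombination] at h
  obtain ⟨c, hc, hc'⟩ := h
  refine ⟨c, fun p hp => hc hp, ?_⟩
  change aeval (R := ℂ) (plueckerCoord Z) (X a * X b - quadForm c) = 0
  rw [map_sub, sub_eq_zero, map_mul, aeval_X, aeval_X, ← hc', Finsupp.linearCombination_apply,
    quadForm, Finsupp.sum, Finsupp.sum, map_sum]
  refine Finset.sum_congr rfl fun p _ => ?_
  rw [map_mul, map_mul, aeval_X, aeval_X, aeval_C, Algebra.smul_def]

theorem exists_of_coeff_quadForm_ne_zero {c : PBWColumn n × PBWColumn n →₀ ℂ}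
    {d : PBWColumn n →₀ ℕ} (h : coeff d (quadForm c) ≠ 0) :
    ∃ p ∈ c.support, d = Finsupp.single p.1 1 + Finsupp.single p.2 1 := by
  classical
  rw [quadForm, Finsupp.sum, coeff_sum] at h
  obtain ⟨p, hp, hne⟩ := Finset.exists_ne_zero_of_sum_ne_zero h
  refine ⟨p, hp, ?_⟩
  rw [coeff_C_mul, X_mul_X_eq_monomial, coeff_monomial] at hne
  by_contra hd
  rw [if_neg (Ne.symm hd), mul_zero] at hne
  exact hne rfl

theorem isStraighteningRelation_of_quadForm {a b : PBWColumn n}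
    {c : PBWColumn n × PBWColumn n →₀ ℂ} (hc : ∀ p ∈ c.support, p.1 ≤ p.2)
    (hrel : X a * X b - quadForm c ∈ plueckerIdeal n) :
    IsStraighteningRelation (plueckerIdeal n) a b (X a * X b - quadForm c) := by
  refine ⟨hrel, fun d hd => ?_⟩
  rw [sub_sub_cancel_left, mem_support_iff, coeff_neg, neg_ne_zero] at hd
  obtain ⟨p, hp, rfl⟩ := exists_of_coeff_quadForm_ne_zero hd
  exact isStandardMonomial_pair (hc p hp)

theorem _root_.IsStraighteningRelation.unique {a b : PBWColumn n} {p q : PlueckerRing n}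
    (hp : IsStraighteningRelation (plueckerIdeal n) a b p)
    (hq : IsStraighteningRelation (plueckerIdeal n) a b q) : p = q := by
  classical
  refine sub_eq_zero.1 (eq_zero_of_mem_plueckerIdeal (sub_mem hp.1 hq.1) fun d hd => ?_)
  rw [← sub_sub_sub_cancel_right p q (X a * X b)] at hd
  rcases Finset.mem_union.1 (support_sub _ _ _ hd) with h | h
  exacts [hp.2 d h, hq.2 d h]

/-- The shape of a straightening relation. -/
theorem exists_quadForm_shape {a b : PBWColumn n} {e : PlueckerRing n}
    (he : IsStraighteningRelation (plueckerIdeal n) a b e) :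
    ∃ c : PBWColumn n × PBWColumn n →₀ ℂ, e = X a * X b - quadForm c ∧
      (∀ p ∈ c.support, p.1 ≤ p.2 ∧ p.1 ≤ a ⊓ b ∧ a ⊔ b ≤ p.2) ∧
      ∃ p₀ ∈ c.support, IsOdot (orderPart n) a b p₀.1 ∧ p₀.2 = a ⊔ b ∧ c p₀ = 1 ∧
        ∀ p ∈ c.support, p.2 = a ⊔ b → p = p₀ := by
  obtain ⟨c, hc, hrel⟩ := exists_quadForm a b
  have hc1 : ∀ p ∈ c.support, p.1 ≤ p.2 := fun p hp => (hc p hp).1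
  have hrel' : C 1 * (X a * X b) - quadForm c ∈ plueckerIdeal n := by rwa [C_1, one_mul]
  obtain ⟨p₀, hp₀, hlead, hone⟩ := exists_leadExp_eq one_ne_zero hc1 hrel'
  have hsup := eq_sup_of_leadExp_add_eq (hc1 p₀ hp₀) hlead
  refine ⟨c, he.unique (isStraighteningRelation_of_quadForm hc1 hrel), fun p hp =>
    ⟨hc1 p hp, le_inf_of_mem_support hc1 hrel hp,
      sup_le_of_leadExp_le (hc1 p hp) (leadExp_le_of_mem_support hc1 hrel' hp)⟩, p₀, hp₀,
    isOdot_of_leadExp_add_eq (hc1 p₀ hp₀) hlead, hsup, hone, fun p hp h => ?_⟩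
  have h1 : p.2 = p₀.2 := h.trans hsup.symm
  have h2 := (hc p hp).2.trans (hc p₀ hp₀).2.symm
  rw [h1] at h2
  exact Prod.ext (entries_injective (Finset.val_injective (add_right_cancel h2))) h1

theorem shape_of_straighteningRelation {a b : PBWColumn n} (hab : ¬ a ≤ b) {e : PlueckerRing n}
    (he : IsStraighteningRelation (plueckerIdeal n) a b e) :
    ∃ (m : ℕ) (g h : Fin (m + 1) → PBWColumn n) (c : Fin (m + 1) → ℂ),
        (∀ i, g i < h i ∧ c i ≠ 0) ∧
        Function.Injective (fun i => (g i, h i)) ∧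
        e = MvPolynomial.X a * MvPolynomial.X b -
          ∑ i, MvPolynomial.C (c i) * (MvPolynomial.X (g i) * MvPolynomial.X (h i)) ∧
        IsOdot (PBWColumn.orderPart n) a b (g 0) ∧ h 0 = a ⊔ b ∧ c 0 = 1 ∧
        ∀ i, i ≠ 0 → g i ≤ a ⊓ b ∧ a ⊔ b < h i := by
  obtain ⟨c, rfl, hc, p₀, hp₀, hodot, hsup, hone, huniq⟩ := exists_quadForm_shape he
  obtain ⟨m, hm⟩ : ∃ m, c.support.card = m + 1 :=
    Nat.exists_eq_succ_of_ne_zero (Finset.card_ne_zero_of_mem hp₀)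
  let f₀ : Fin (m + 1) ≃ c.support := (Finset.equivFinOfCardEq hm).symm
  -- The swap gives the distinguished term index 0.
  let f : Fin (m + 1) ≃ c.support := (Equiv.swap 0 (f₀.symm ⟨p₀, hp₀⟩)).trans f₀
  have hf0 : f 0 = ⟨p₀, hp₀⟩ := by simp [f]
  have hlt : a ⊓ b < a ⊔ b := lt_of_le_not_ge inf_le_sup fun h =>
    hab (le_sup_left.trans (h.trans inf_le_right))
  refine ⟨m, fun i => (f i).1.1, fun i => (f i).1.2, fun i => c (f i).1, fun i => ?_, ?_, ?_, ?_,
    ?_, ?_, fun i hi => ?_⟩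
  · have h1 := hc _ (f i).2
    exact ⟨h1.2.1.trans_lt (hlt.trans_le h1.2.2), Finsupp.mem_support_iff.1 (f i).2⟩
  · exact fun i j h => f.injective (Subtype.ext h)
  · rw [quadForm, Finsupp.sum, ← Finset.sum_coe_sort, ← f.sum_comp]
  · simp only [hf0, hodot]
  · simp only [hf0, hsup]
  · simp only [hf0, hone]
  · have h1 := hc _ (f i).2
    refine ⟨h1.2.1, lt_of_le_of_ne h1.2.2 fun h => hi (f.injective ?_)⟩
    rw [hf0]
    exact Subtype.ext (huniq _ (f i).2 h.symm)

/-! ### Generation and minimality -/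

/-- A strictly monotone bounded function on columns. -/
def rank (a : PBWColumn n) : ℕ := ∑ r ∈ Finset.range n, a.prof r

theorem rank_le (a : PBWColumn n) : a.rank ≤ n * n := by
  refine (Finset.sum_le_sum fun r _ => a.prof_le r).trans ?_
  simp

theorem rank_mono {a b : PBWColumn n} (h : a ≤ b) : a.rank ≤ b.rank :=
  Finset.sum_le_sum fun r _ => le_iff_prof.1 h r

theorem rank_strictMono {a b : PBWColumn n} (h : a < b) : a.rank < b.rank := by
  have h1 := le_iff_prof.1 h.le
  obtain ⟨r, hr⟩ : ∃ r, a.prof r < b.prof r := by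
    by_contra hc
    push Not at hc
    exact h.not_ge (le_iff_prof.2 hc)
  refine Finset.sum_lt_sum (fun r _ => h1 r) ⟨r, Finset.mem_range.2 ?_, hr⟩
  exact (b.lt_len_iff_prof_pos.2 (by omega)).trans b.len_lt

/-- A weight of monomials that grows under straightening. -/
def monomialWeight (d : PBWColumn n →₀ ℕ) : ℕ := d.sum fun a k => k * 2 ^ a.rank

theorem monomialWeight_add (d e : PBWColumn n →₀ ℕ) :
    monomialWeight (d + e) = monomialWeight d + monomialWeight e :=
  Finsupp.sum_add_index' (by simp) fun _ _ _ => add_mul _ _ _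

theorem monomialWeight_single (a : PBWColumn n) :
    monomialWeight (Finsupp.single a 1) = 2 ^ a.rank := by
  simp [monomialWeight]

theorem monomialWeight_le (d : PBWColumn n →₀ ℕ) :
    monomialWeight d ≤ d.degree * 2 ^ (n * n) := by
  rw [monomialWeight, Finsupp.sum, Finsupp.degree_apply, Finset.sum_mul]
  exact Finset.sum_le_sum fun a _ =>
    Nat.mul_le_mul_left _ (Nat.pow_le_pow_right two_pos a.rank_le)

/-- By incomparability `h` lies strictly above both columns, so `2 ^ h.rank` is at least twice each
term on the left and hence at least their sum; `g` makes the inequality strict. -/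
theorem two_pow_rank_lt {a b g h : PBWColumn n} (hab : ¬ a ≤ b) (hba : ¬ b ≤ a)
    (hh : a ⊔ b ≤ h) : 2 ^ a.rank + 2 ^ b.rank < 2 ^ g.rank + 2 ^ h.rank := by
  have h1 : a.rank < h.rank := (rank_strictMono (left_lt_sup.2 hba)).trans_le (rank_mono hh)
  have h2 : b.rank < h.rank := (rank_strictMono (right_lt_sup.2 hab)).trans_le (rank_mono hh)
  have h3 := Nat.pow_le_pow_right two_pos (Nat.succ_le_of_lt h1)
  have h4 := Nat.pow_le_pow_right two_pos (Nat.succ_le_of_lt h2)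
  have h5 : 0 < 2 ^ g.rank := by positivity
  rw [pow_succ] at h3 h4
  omega

/-- The set of all straightening relations. -/
def straighteningRelations (n : ℕ) : Set (PlueckerRing n) :=
  {p | ∃ a b : PBWColumn n, ¬ a ≤ b ∧ ¬ b ≤ a ∧
        IsStraighteningRelation (plueckerIdeal n) a b p}

theorem exists_straighteningRelation (a b : PBWColumn n) :
    ∃ p, IsStraighteningRelation (plueckerIdeal n) a b p := by
  obtain ⟨c, hc, hrel⟩ := exists_quadForm a b
  exact ⟨_, isStraighteningRelation_of_quadForm (fun p hp => (hc p hp).1) hrel⟩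

/-- Straightening one incomparable pair keeps the degree and raises the weight, which is bounded in
each degree, so rewriting terminates. -/
theorem monomial_mem_sup (d : PBWColumn n →₀ ℕ) : (monomial d 1 : PlueckerRing n) ∈
    (Ideal.span (straighteningRelations n)).restrictScalars ℂ ⊔
      restrictSupport ℂ {d | IsStandardMonomial d} := by
  set S := (Ideal.span (straighteningRelations n)).restrictScalars ℂ ⊔
      restrictSupport ℂ {d | IsStandardMonomial d} with hS
  induction hN : d.degree * 2 ^ (n * n) - monomialWeight d using Nat.strong_induction_on
    generalizing d with
  | _ N ih =>
    by_cases hd : IsStandardMonomial d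
    · refine Submodule.mem_sup_right ?_
      rw [mem_restrictSupport_iff]
      intro x hx
      rwa [Finset.mem_singleton.1 (support_monomial_subset hx)]
    · simp only [IsStandardMonomial, not_forall, not_or] at hd
      obtain ⟨a, ha, b, hb, hab, hba⟩ := hd
      have hne : a ≠ b := fun h => hab h.le
      obtain ⟨d', rfl⟩ : ∃ d', d = d' + (Finsupp.single a 1 + Finsupp.single b 1) := by
        classical
        refine ⟨d - (Finsupp.single a 1 + Finsupp.single b 1),
          (tsub_add_cancel_of_le fun x => ?_).symm⟩
        rw [Finsupp.mem_support_iff] at ha hb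
        rw [Finsupp.add_apply, Finsupp.single_apply, Finsupp.single_apply]
        split_ifs with h1 h2 h2
        · exact (hne (h1.trans h2.symm)).elim
        all_goals subst_vars; omega
      obtain ⟨e, he⟩ := exists_straighteningRelation a b
      obtain ⟨c, rfl, hc, -⟩ := exists_quadForm_shape he
      have h1 : (monomial (d' + (Finsupp.single a 1 + Finsupp.single b 1)) 1 : PlueckerRing n) =
          monomial d' 1 * (X a * X b - quadForm c) + monomial d' 1 * quadForm c := by
        rw [← mul_add, sub_add_cancel, X_mul_X_eq_monomial, monomial_mul, one_mul]
      rw [h1]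
      refine S.add_mem (Submodule.mem_sup_left
        (Ideal.mul_mem_left _ _ (Ideal.subset_span ⟨a, b, hab, hba, he⟩))) ?_
      rw [quadForm, Finsupp.mul_sum]
      refine S.sum_mem fun p hp => ?_
      have h2 : (monomial d' 1 * (C (c p) * (X p.1 * X p.2)) : PlueckerRing n) =
          c p • monomial (d' + (Finsupp.single p.1 1 + Finsupp.single p.2 1)) 1 := by
        rw [mul_left_comm, X_mul_X_eq_monomial, monomial_mul, one_mul, C_mul']
      simp only [h2]
      refine S.smul_mem _ (ih _ ?_ _ rfl)
      have h3 := two_pow_rank_lt (g := p.1) hab hba (hc p hp).2.2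
      have h4 := monomialWeight_le (d' + (Finsupp.single p.1 1 + Finsupp.single p.2 1))
      simp only [monomialWeight_add, monomialWeight_single, map_add, Finsupp.degree_single]
        at hN h4 ⊢
      omega

theorem mem_sup_restrictSupport (q : PlueckerRing n) : q ∈
    (Ideal.span (straighteningRelations n)).restrictScalars ℂ ⊔
      restrictSupport ℂ {d | IsStandardMonomial d} := by
  rw [← support_sum_monomial_coeff q]
  refine Submodule.sum_mem _ fun d _ => ?_
  rw [← mul_one (coeff d q), ← smul_eq_mul, ← smul_monomial]
  exact Submodule.smul_mem _ _ (monomial_mem_sup d)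

theorem span_straighteningRelations_le :
    Ideal.span (straighteningRelations n) ≤ plueckerIdeal n :=
  Ideal.span_le.2 fun _ ⟨_, _, _, _, h⟩ => h.1

/-- The straightening relations generate the Plücker ideal. -/
theorem span_straighteningRelations :
    Ideal.span (straighteningRelations n) = plueckerIdeal n := by
  refine le_antisymm span_straighteningRelations_le fun q hq => ?_
  obtain ⟨j, hj, s, hs, rfl⟩ := Submodule.mem_sup.1 (mem_sup_restrictSupport q)
  have hj' : j ∈ Ideal.span (straighteningRelations n) := hj
  have : s = 0 := eq_zero_of_mem_plueckerIdeal
    ((Submodule.add_mem_iff_right _ (span_straighteningRelations_le hj')).1 hq)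
    fun d hd => ((mem_restrictSupport_iff ℂ).1 hs) hd
  rwa [this, add_zero]

/-- All the relations are quadratic, and the nonstandard monomial `X_a X_b` occurs only in its own
relation; without it, that monomial has coefficient zero throughout the ideal. -/
theorem minimal_straighteningRelations :
    Minimal (fun S : Set (PlueckerRing n) => Ideal.span S = plueckerIdeal n)
      (straighteningRelations n) := by
  classical
  refine ⟨span_straighteningRelations, fun S hS hle e he => ?_⟩
  obtain ⟨a, b, hab, hba, hrel⟩ := he
  by_contra hnot
  have hmem : e ∈ Ideal.span S := by
    rw [hS]
    exact hrel.1
  set m : PBWColumn n →₀ ℕ := Finsupp.single a 1 + Finsupp.single b 1 with hm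
  have hdeg : m.degree = 2 := by simp [hm]
  -- Covering all divisors of `m` makes the claim stable under multiplication by arbitrary
  -- polynomials.
  have key : ∀ q ∈ Ideal.span S, ∀ d ≤ m, coeff d q = 0 := by
    intro q hq
    refine Submodule.span_induction (p := fun q _ => ∀ d ≤ m, coeff d q = 0) ?_ ?_ ?_ ?_ hq
    · intro s hs d hd
      by_contra hne
      obtain ⟨a', b', hab', hba', hrel'⟩ := hle hs
      obtain ⟨c, hsc, hc, -⟩ := exists_quadForm_shape hrel'
      have hd' : d = Finsupp.single a' 1 + Finsupp.single b' 1 ∨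
          ∃ p ∈ c.support, d = Finsupp.single p.1 1 + Finsupp.single p.2 1 := by
        by_contra hcon
        rw [not_or] at hcon
        refine hne ?_
        rw [hsc, coeff_sub, X_mul_X_eq_monomial, coeff_monomial, if_neg (Ne.symm hcon.1), zero_sub,
          neg_eq_zero]
        by_contra h0
        exact hcon.2 (exists_of_coeff_quadForm_ne_zero h0)
      have hdm : d = m := by
        have h1 : d.degree = 2 := by
          rcases hd' with rfl | ⟨p, -, rfl⟩ <;> simp
        have h2 : (m - d).degree = 0 := by
          have := congrArg Finsupp.degree (tsub_add_cancel_of_le hd)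
          rw [map_add] at this
          omega
        rw [Finsupp.degree_eq_zero_iff] at h2
        exact le_antisymm hd (tsub_eq_zero_iff_le.1 h2)
      rcases hd' with h | ⟨p, hp, h⟩
      · refine hnot ?_
        have h1 : IsStraighteningRelation (plueckerIdeal n) a b s := by
          rw [IsStraighteningRelation, X_mul_X_eq_monomial, ← hm, ← hdm, h, ← X_mul_X_eq_monomial]
          exact hrel'
        rwa [hrel.unique h1]
      · refine not_isStandardMonomial_pair hab hba ?_
        rw [← hm, ← hdm, h]
        exact isStandardMonomial_pair (hc p hp).1
    · exact fun d _ => coeff_zero d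
    · intro x y _ _ hx hy d hd
      rw [coeff_add, hx d hd, hy d hd, add_zero]
    · intro f x _ hx d hd
      rw [smul_eq_mul, coeff_mul]
      refine Finset.sum_eq_zero fun ij hij => ?_
      have : ij.2 ≤ d := by
        rw [← Finset.HasAntidiagonal.mem_antidiagonal.1 hij]
        exact le_add_self
      rw [hx _ (this.trans hd), mul_zero]
  have h0 := key e hmem m le_rfl
  have h1 : coeff m (e - X a * X b) = 0 := by
    by_contra hne
    exact not_isStandardMonomial_pair hab hba (hrel.2 m (mem_support_iff.2 hne))
  rw [coeff_sub, h0, X_mul_X_eq_monomial, ← hm, coeff_monomial, if_pos rfl] at h1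
  norm_num at h1

/-! ### The algebra with straightening laws -/

/-- The Plücker algebra is an algebra with straightening laws on the lattice of columns. -/
theorem isASL_plueckerAlgebra (n : ℕ) :
    IsASL (fun b : PBWColumn n => Ideal.Quotient.mk (plueckerIdeal n) (MvPolynomial.X b)) where
  injective := by
    intro a b h
    have hstd : ∀ a : PBWColumn n, IsStandardMonomial (Finsupp.single a 1) := by
      intro a x hx y hy
      rw [Finset.mem_singleton.1 (Finsupp.support_single_subset hx),
        Finset.mem_singleton.1 (Finsupp.support_single_subset hy)]
      exact Or.inl le_rfl
    have h1 := (linearIndependent_standard n).injective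
      (a₁ := ⟨Finsupp.single a 1, hstd a⟩) (a₂ := ⟨Finsupp.single b 1, hstd b⟩) (by simpa using h)
    exact (Finsupp.single_left_injective one_ne_zero) (Subtype.ext_iff.1 h1)
  linearIndependent := linearIndependent_standard n
  span_eq_top := by
    refine Submodule.eq_top_iff'.2 fun x => ?_
    obtain ⟨q, rfl⟩ := Ideal.Quotient.mk_surjective x
    obtain ⟨j, hj, s, hs, rfl⟩ := Submodule.mem_sup.1 (mem_sup_restrictSupport q)
    have hj' : j ∈ Ideal.span (straighteningRelations n) := hj
    rw [map_add, Ideal.Quotient.eq_zero_iff_mem.2 (span_straighteningRelations_le hj'), zero_add,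
      ← support_sum_monomial_coeff s, map_sum]
    refine Submodule.sum_mem _ fun d hd => ?_
    have : Ideal.Quotient.mk (plueckerIdeal n) (monomial d (coeff d s)) =
        coeff d s • Ideal.Quotient.mk (plueckerIdeal n) (monomial d 1) := by
      rw [← mul_one (coeff d s), ← smul_eq_mul, ← smul_monomial, smul_eq_mul, mul_one]
      rfl
    rw [this, mk_monomial]
    exact Submodule.smul_mem _ _
      (Submodule.subset_span ⟨⟨d, ((mem_restrictSupport_iff ℂ).1 hs) hd⟩, rfl⟩)
  straightening := by
    intro a b _ _ c hc d hd
    classical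
    set q : PlueckerRing n := c.sum fun d x => monomial d.1 x with hq
    have hcoeff : ∀ d' : PBWColumn n →₀ ℕ, coeff d' q ≠ 0 → IsStandardMonomial d' := by
      intro d' hne
      rw [hq, Finsupp.sum, coeff_sum] at hne
      obtain ⟨x, -, hx⟩ := Finset.exists_ne_zero_of_sum_ne_zero hne
      rw [coeff_monomial] at hx
      have : x.1 = d' := by
        by_contra h
        exact hx (if_neg h)
      exact this ▸ x.2
    -- Any standard expansion of the product lifts to a straightening relation, so uniqueness gives
    -- it the known shape.
    have hrel : IsStraighteningRelation (plueckerIdeal n) a b (X a * X b - q) := by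
      constructor
      · rw [← Ideal.Quotient.eq_zero_iff_mem, map_sub, map_mul, hc, sub_eq_zero, hq, Finsupp.sum,
          Finsupp.sum, map_sum]
        refine Finset.sum_congr rfl fun d _ => ?_
        rw [← mk_monomial, ← mul_one (c d), ← smul_eq_mul (c d), ← smul_monomial, smul_eq_mul,
          mul_one]
        rfl
      · intro d' hd'
        rw [sub_sub_cancel_left, mem_support_iff, coeff_neg, neg_ne_zero] at hd'
        exact hcoeff d' hd'
    obtain ⟨c₀, heq, hc₀, -⟩ := exists_quadForm_shape hrel
    have hd' : coeff d.1 (quadForm c₀) ≠ 0 := by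
      rw [← sub_right_inj.1 heq, hq, Finsupp.sum, coeff_sum, Finset.sum_eq_single d]
      · rw [coeff_monomial, if_pos rfl]
        exact Finsupp.mem_support_iff.1 hd
      · intro x _ hx
        rw [coeff_monomial, if_neg fun h => hx (Subtype.ext h)]
      · exact fun h => (h hd).elim
    obtain ⟨p, hp, hdp⟩ := exists_of_coeff_quadForm_ne_zero hd'
    have hp' := hc₀ p hp
    refine ⟨p.1, ?_, fun ω hω => ?_, hp'.2.1.trans inf_le_left, hp'.2.1.trans inf_le_right⟩
    · rw [hdp]
      simp
    · rw [hdp] at hω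
      rcases Finset.mem_union.1 (Finsupp.support_add hω) with h | h
      · rw [Finset.mem_singleton.1 (Finsupp.support_single_subset h)]
      · rw [Finset.mem_singleton.1 (Finsupp.support_single_subset h)]
        exact hp'.1

end PBWColumn

theorem mainTheorem5 (n : ℕ) (hn : 2 ≤ n) :
    -- for incomparable `a`, `b` there is exactly one straightening relation `e(a, b)`
    (∀ a b : PBWColumn n, ¬ a ≤ b → ¬ b ≤ a →
      ∃! p, IsStraighteningRelation (plueckerIdeal n) a b p) ∧
    -- the relations `e(a, b)` form a minimal generating set of the Plücker ideal
    Minimal (fun S : Set (PlueckerRing n) => Ideal.span S = plueckerIdeal n)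
      {p | ∃ a b : PBWColumn n, ¬ a ≤ b ∧ ¬ b ≤ a ∧
        IsStraighteningRelation (plueckerIdeal n) a b p} ∧
    -- the shape of `e(a, b)`
    (∀ a b : PBWColumn n, ¬ a ≤ b → ¬ b ≤ a →
      ∀ e, IsStraighteningRelation (plueckerIdeal n) a b e →
      ∃ (m : ℕ) (g h : Fin (m + 1) → PBWColumn n) (c : Fin (m + 1) → ℂ),
        (∀ i, g i < h i ∧ c i ≠ 0) ∧
        Function.Injective (fun i => (g i, h i)) ∧
        e = MvPolynomial.X a * MvPolynomial.X b -
          ∑ i, MvPolynomial.C (c i) * (MvPolynomial.X (g i) * MvPolynomial.X (h i)) ∧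
        IsOdot (PBWColumn.orderPart n) a b (g 0) ∧ h 0 = a ⊔ b ∧ c 0 = 1 ∧
        ∀ i, i ≠ 0 → g i ≤ a ⊓ b ∧ a ⊔ b < h i) ∧
    -- the Plücker algebra is an algebra with straightening laws
    IsASL (fun b : PBWColumn n => Ideal.Quotient.mk (plueckerIdeal n) (MvPolynomial.X b)) := by
  refine ⟨fun a b _ _ => ?_, PBWColumn.minimal_straighteningRelations,
    fun a b hab _ e he => PBWColumn.shape_of_straighteningRelation hab he,
    PBWColumn.isASL_plueckerAlgebra n⟩
  obtain ⟨p, hp⟩ := PBWColumn.exists_straighteningRelation a b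
  exact ⟨p, hp, fun q hq => hq.unique hp⟩
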